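/- **Setting.** A tropical polynomial in three variables is a function $f(x)=\max_{a\in\mathcal A}(\lambda_a+\langle a,x\rangle)$ on $\mathbb R^3$, with $\mathcal A\subset\mathbb N_0^3$ finite and $\lambda_a\in\mathbb R$. Its tropical surface $X=V_{tr}(f)$ is the set of points where the maximum is attained at least twice. Let $\mathrm{Subdiv}(f)$ be the regular subdivision of $\mathrm{conv}(\mathcal A)$ obtained by projecting the top faces of $\mathrm{conv}\{(a,\lambda_a)\mid a\in\mathcal A\}\subset\mathbb R^4$ to $\mathbb R^3$. The (closed) cells of $X$ are the sets $\Delta^\vee$, for $\Delta\in\mathrm{Subdiv}(f)$ with $\dim\Delta\ge 1$, where $\Delta^\vee$ is the set of points $x$ at which all vertices $a$ of $\Delta$ attain the maximum $f(x)$. The surface $X$ has degree $\delta$ if $\mathrm{conv}(\mathcal A)=\mathrm{conv}\{0,\delta e_1,\delta e_2,\delta e_3\}$, and it is smooth if moreover all maximal cells of $\mathrm{Subdiv}(f)$ are lattice tetrahedra of volume $\frac16$. For $p\in X$ let $c_X(p)$ be the smallest cell of $X$ containing $p$; for a ray or (possibly one-point) segment $\ell\subseteq X$ let $$\mathcal C_X(\ell)=\{c_X(p)\mid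 p\in\ell,\ c_X(q)=c_X(p)\text{ for all } q\in\ell \text{ sufficiently close to } p\}.$$ A tropical line is a subset $L$ of $\mathbb R^3$ consisting of a bounded segment $\ell_5$, of length $\ge 0$, with endpoints $v_1,v_2$ (the vertices), and of four rays $\ell_1,\dots,\ell_4$ with directions $-e_1,-e_2,-e_3,e_1+e_2+e_3$, two of them starting at $v_1$ and the other two at $v_2$, such that at each vertex the primitive integer vectors in the directions of the outgoing edges sum to zero. If $v_1=v_2$, the line is degenerate and its combinatorial type $\kappa$ is $(1234)$; otherwise $\kappa$ is the partition of $\{1,2,3,4\}$ into the two pairs of indices of rays that share a vertex. To a tropical line $L\subseteq X$ we associate the data $$\mathcal D_X(L)=\big(\{c_X(v_1),c_X(v_2)\},\ \mathcal C_X(\ell_1),\dots,\mathcal C_X(\ell_5),\ \kappa\big).$$ A two-point family on $X$ is an infinite set of tropical lines, all contained in $X$ and all passing through the same two distinct points of $\mathbb R^3$. A tropical line $L\subseteq X$ is isolated on $X$ if it belongs to no two-point family on $X$. **Proposition.** Let $X$ be a smooth tropical surface of degree $\delta\ge 3$ and let $L\subseteq X$ be a tropical line that is isolated on $X$. Then $L$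 is uniquely determined by $\mathcal D_X(L)$: every tropical line $L'\subseteq X$ with $\mathcal D_X(L')=\mathcal D_X(L)$ is equal to $L$. -/

import Mathlib

open Topology

noncomputable section

namespace TropGeom

/-- Points of `ℝ³`. -/
abbrev Space : Type := Fin 3 → ℝ

/-- A tropical polynomial in three variables, `x ↦ max_{a ∈ support} (coeff a + ⟨a, x⟩)`.
Only the values of `coeff` on `support` are ever used. -/
structure TropPoly where
  support : Finset (Fin 3 → ℕ)
  coeff : (Fin 3 → ℕ) → ℝ

/-- An exponent vector, seen as a point of `ℝ³`. -/
def expPoint (a : Fin 3 → ℕ) : Space := fun i => (a i : ℝ)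

namespace TropPoly

variable (f : TropPoly)

/-- The value at `x` of the tropical monomial with exponent `a`. -/
def mono (a : Fin 3 → ℕ) (x : Space) : ℝ := f.coeff a + dotProduct (expPoint a) x

/-- The monomial with exponent `a` attains the maximum at `x`. -/
def IsMaxAt (a : Fin 3 → ℕ) (x : Space) : Prop :=
  a ∈ f.support ∧ ∀ b ∈ f.support, f.mono b x ≤ f.mono a x

/-- The tropical surface `V_tr(f)`: the points where the maximum is attained at least twice. -/
def surface : Set Space := {x | ∃ a b, a ≠ b ∧ f.IsMaxAt a x ∧ f.IsMaxAt b x}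

/-- The Newton polytope of `f`. -/
def newtonPolytope : Set Space := convexHull ℝ (expPoint '' (f.support : Set (Fin 3 → ℕ)))

/-- The convex hull in `ℝ³ × ℝ` of the lifted exponent vectors `(a, coeff a)`. -/
def liftedPolytope : Set (Space × ℝ) :=
  convexHull ℝ ((fun a => (expPoint a, f.coeff a)) '' (f.support : Set (Fin 3 → ℕ)))

/-- The top face of the lifted polytope with outward normal vector `(x, 1)`. -/
def topFace (x : Space) : Set (Space × ℝ) :=
  {z ∈ f.liftedPolytope | ∀ w ∈ f.liftedPolytope,
    dotProduct x w.1 + w.2 ≤ dotProduct x z.1 + z.2}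

/-- The regular subdivision of the Newton polytope induced by the coefficients of `f`: its cells
are the projections to `ℝ³` of the (nonempty) top faces of the lifted polytope. -/
def subdiv : Set (Set Space) := {D | ∃ x : Space, D = Prod.fst '' f.topFace x}

/-- The dual of a cell `D` of the subdivision: the set of the points `x` at which all the vertices
of `D` attain the maximum of the monomials of `f`. -/
def dualCell (D : Set Space) : Set Space :=
  {x | ∀ a ∈ f.support, expPoint a ∈ Set.extremePoints ℝ D →
    ∀ b ∈ f.support, f.mono b x ≤ f.mono a x}

/-- The (nonempty) closed cells of the surface `V_tr(f)`: the duals of the cells of dimension at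
least `1` (that is, with more than one point) of the subdivision. -/
def cells : Set (Set Space) := {C | ∃ D ∈ f.subdiv, D.Nontrivial ∧ C = f.dualCell D}

/-- `c_X(p)`, the smallest cell of the surface that contains the point `p` of the surface,
written as the intersection of all the cells that contain `p`. -/
def minCell (p : Space) : Set Space := ⋂₀ {C | C ∈ f.cells ∧ p ∈ C}

/-- `𝒞_X(ℓ)`: the cells `c_X(p)`, for `p ∈ ℓ` such that `c_X(q) = c_X(p)` for all `q ∈ ℓ`
sufficiently close to `p`. -/
def cellsThrough (l : Set Space) : Set (Set Space) :=
  {C | ∃ p ∈ l, C = f.minCell p ∧ ∀ᶠ q in 𝓝[l] p, f.minCell q = f.minCell p}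

end TropPoly

/-- The simplex `Γ_δ = conv {0, δ e₁, δ e₂, δ e₃}`. -/
def simplexGamma (δ : ℕ) : Set Space :=
  convexHull ℝ (insert 0 (Set.range fun i : Fin 3 => (Pi.single i (δ : ℝ) : Space)))

/-- An elementary (unimodular) tetrahedron: the convex hull of four lattice points whose volume is
`1/6`, i.e. such that the three edge vectors at one vertex have determinant `±1`. -/
def IsElementaryTetrahedron (D : Set Space) : Prop :=
  ∃ v : Fin 4 → Fin 3 → ℤ,
    D = convexHull ℝ (Set.range fun i : Fin 4 => ((fun k => (v i k : ℝ)) : Space)) ∧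
    |(Matrix.of fun i k : Fin 3 => v i.succ k - v 0 k).det| = 1

/-- The surface `V_tr(f)` has degree `δ`. -/
def TropPoly.HasDegree (f : TropPoly) (δ : ℕ) : Prop := f.newtonPolytope = simplexGamma δ

/-- The surface `V_tr(f)` (of some degree) is smooth: the subdivision induced by `f` is an
elementary triangulation, i.e. all its maximal cells are elementary tetrahedra. -/
def TropPoly.IsSmooth (f : TropPoly) : Prop :=
  ∀ D : Set Space, Maximal (fun D => D ∈ f.subdiv) D → IsElementaryTetrahedron D

/-- The directions `-e₁, -e₂, -e₃, e₁ + e₂ + e₃` of the four rays of a tropical line. -/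
def rayDir : Fin 4 → Fin 3 → ℤ := ![![-1, 0, 0], ![0, -1, 0], ![0, 0, -1], ![1, 1, 1]]

/-- An integer vector as a vector of `ℝ³`. -/
def intVec (u : Fin 3 → ℤ) : Space := fun k => (u k : ℝ)

/-- A tropical line in `ℝ³`, as a balanced realization of the tree with two 3-valent vertices and
four leaves. The bounded edge runs from `v₁` to `v₂`, with primitive integer direction `dir`; the
rays with index in `near` start at `v₁`, the other two at `v₂`. The line is degenerate if the
bounded edge has length zero. The same point set has several such descriptions (the vertices may
be exchanged and, if the line is degenerate, `near` is arbitrary), so tropical lines are to be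
compared through `TropLine.carrier`. -/
structure TropLine where
  v₁ : Space
  v₂ : Space
  near : Finset (Fin 4)
  card_near : near.card = 2
  dir : Fin 3 → ℤ
  dir_primitive : ∀ d : ℤ, (∀ k, d ∣ dir k) → IsUnit d
  len : ℝ
  len_nonneg : 0 ≤ len
  v₂_eq : v₂ = v₁ + len • intVec dir
  balanced₁ : ∑ i ∈ near, rayDir i + dir = 0
  balanced₂ : ∑ i ∈ nearᶜ, rayDir i + -dir = 0

namespace TropLine

variable (L : TropLine)

/-- The ray `ℓᵢ` (indices `0, 1, 2, 3` instead of `1, 2, 3, 4`). -/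
def ray (i : Fin 4) : Set Space :=
  {p | ∃ s : ℝ, 0 ≤ s ∧ p = (if i ∈ L.near then L.v₁ else L.v₂) + s • intVec (rayDir i)}

/-- The bounded edge `ℓ₅`. -/
def seg : Set Space := segment ℝ L.v₁ L.v₂

/-- The underlying point set of a tropical line. -/
def carrier : Set Space := L.seg ∪ ⋃ i, L.ray i

open Classical in
/-- The combinatorial type: `{{i, j}, {k, l}}` if the rays `i, j` are adjacent and the rays `k, l`
are adjacent in a non-degenerate line, and `{{0, 1, 2, 3}}` for a degenerate line. -/
def combType : Finset (Finset (Fin 4)) :=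
  if L.v₁ = L.v₂ then {Finset.univ} else {L.near, L.nearᶜ}

end TropLine

/-- Data of the kind of `𝒟_X(L)`. -/
structure CombData where
  vertexCells : Set (Set Space)
  rayCells : Fin 4 → Set (Set Space)
  segCells : Set (Set Space)
  kappa : Finset (Finset (Fin 4))

/-- The data `𝒟_X(L)` of a tropical line `L` on the surface `X = V_tr(f)`: the (unordered) cells
`c_X(v₁), c_X(v₂)`, the sets `𝒞_X(ℓ₁), …, 𝒞_X(ℓ₄)`, `𝒞_X(ℓ₅)`, and the combinatorial type. -/
def TropPoly.data (f : TropPoly) (L : TropLine) : CombData where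
  vertexCells := {f.minCell L.v₁, f.minCell L.v₂}
  rayCells := fun i => f.cellsThrough (L.ray i)
  segCells := f.cellsThrough L.seg
  kappa := L.combType

/-- A two-point family of tropical lines: an infinite collection of tropical lines, all of which
contain the same two distinct points. -/
def IsTwoPointFamily (F : Set (Set Space)) : Prop :=
  F.Infinite ∧ (∀ S ∈ F, ∃ L : TropLine, S = L.carrier) ∧
    ∃ P Q : Space, P ≠ Q ∧ ∀ S ∈ F, P ∈ S ∧ Q ∈ S

/-- A tropical line is isolated on `V_tr(f)` if it belongs to no two-point family all of whose
members are contained in `V_tr(f)`. -/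
def TropPoly.IsIsolated (f : TropPoly) (L : TropLine) : Prop :=
  ¬ ∃ F : Set (Set Space), IsTwoPointFamily F ∧ (∀ S ∈ F, S ⊆ f.surface) ∧ L.carrier ∈ F

end TropGeom

end

namespace TropGeom

/-! ### Active exponents -/

/-! The proof works with active sets, the sets of exponents attaining the maximum at a point: two
points of `X` have the same smallest cell exactly when their active sets agree (`minCell_eq_iff`).
Suppose that `L' ≠ L` has the same data as an isolated `L`. After a change of description both lines
have the same distribution of rays, and moving the first vertex and the edge length affinely from
one line to the other gives a pencil of lines `L_t`. Parallel rays or segments running through the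
same cells can be matched along the common direction so that a prescribed weighted mean comes from
two points of a common cell; cells are convex, so every `L_t` stays in `X`
(`interpolate_mem_surface`). It remains to show that such a pencil forces a two-point family through
`L` (`not_isIsolated_of_pencil`).

If a vertex slides along one of its rays, or the bounded edge slides along itself, nearby lines of
the pencil share two points. Otherwise every edge of the line sweeps out a planar region. An
elementary tetrahedron has no two parallel edges, so a single pair of exponents stays active on the
whole region (`exists_pair_of_plane`). If two rays at one vertex have the same pair, the vertex can
be pushed into the cone they span, which again gives a two-point family
(`not_isIsolated_of_adjacent_rays`). So the pairs at a vertex are distinct edges of one elementary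
tetrahedron, all orthogonal to the velocity of the vertex, and therefore sides of one triangle
(`exists_triangle`). A degenerate line would need four distinct sides, which is absurd.

For a nondegenerate line with rays `i, j` at one vertex and `k, l` at the other, the two triangles
share the side `{a, b}` of the bounded edge. The side belonging to ray `m` lies in the facet of
`Γ_δ` where the `m`-th barycentric coordinate (scaled to total `δ`) vanishes. Levelness of `{a, b}`
along the bounded edge makes the `j`-coordinate of `a` equal to the `i`-coordinate of `b`, and
unimodularity of the first triangle makes this number divide `1`; the same holds for the
`l`-coordinate of `a` in the second triangle. The other two coordinates of `a` vanish, so `δ ≤ 2`.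
-/

lemma expPoint_injective : Function.Injective expPoint := fun a b h => by
  funext k
  have := congrFun h k
  simpa [expPoint] using this

namespace TropPoly

variable (f : TropPoly)

lemma mono_add (a : Fin 3 → ℕ) (x y : Space) :
    f.mono a (x + y) = f.mono a x + expPoint a ⬝ᵥ y := by
  simp only [mono, dotProduct_add]; ring

lemma mono_add_smul (a : Fin 3 → ℕ) (x d : Space) (s : ℝ) :
    f.mono a (x + s • d) = f.mono a x + s * (expPoint a ⬝ᵥ d) := by
  rw [mono_add, dotProduct_smul, smul_eq_mul]

lemma mono_combo (a : Fin 3 → ℕ) (x y : Space) {s t : ℝ} (hst : s + t = 1) :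
    f.mono a (s • x + t • y) = s * f.mono a x + t * f.mono a y := by
  simp only [mono, dotProduct_add, dotProduct_smul, smul_eq_mul]
  linear_combination (-f.coeff a) * hst

@[fun_prop]
lemma continuous_mono (a : Fin 3 → ℕ) : Continuous (f.mono a) := by
  unfold mono dotProduct
  fun_prop

open Classical in
/-- The exponents whose monomials attain the maximum at `x`. -/
noncomputable def active (x : Space) : Finset (Fin 3 → ℕ) := {a ∈ f.support | f.IsMaxAt a x}

variable {f}

lemma mem_active {a : Fin 3 → ℕ} {x : Space} : a ∈ f.active x ↔ f.IsMaxAt a x := by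
  classical
  simp only [active, Finset.mem_filter, and_iff_right_iff_imp]
  exact fun h => h.1

lemma active_subset_support (x : Space) : f.active x ⊆ f.support := fun _ h => (mem_active.1 h).1

lemma mono_le_of_mem_active {a b : Fin 3 → ℕ} {x : Space} (ha : a ∈ f.active x)
    (hb : b ∈ f.support) : f.mono b x ≤ f.mono a x := (mem_active.1 ha).2 b hb

lemma mono_eq_of_mem_active {a b : Fin 3 → ℕ} {x : Space} (ha : a ∈ f.active x)
    (hb : b ∈ f.active x) : f.mono a x = f.mono b x :=
  le_antisymm (mono_le_of_mem_active hb (active_subset_support x ha))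
    (mono_le_of_mem_active ha (active_subset_support x hb))

lemma mem_active_of_mono_eq {a b : Fin 3 → ℕ} {x : Space} (ha : a ∈ f.active x)
    (hb : b ∈ f.support) (h : f.mono b x = f.mono a x) : b ∈ f.active x :=
  mem_active.2 ⟨hb, fun _ hc => h ▸ mono_le_of_mem_active ha hc⟩

lemma active_nonempty (hf : f.support.Nonempty) (x : Space) : (f.active x).Nonempty := by
  obtain ⟨a, ha, h⟩ := f.support.exists_max_image (fun a => f.mono a x) hf
  exact ⟨a, mem_active.2 ⟨ha, h⟩⟩

lemma mem_surface_iff {x : Space} :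
    x ∈ f.surface ↔ ∃ a b, a ≠ b ∧ a ∈ f.active x ∧ b ∈ f.active x := by
  simp only [surface, Set.mem_ofPred_eq, mem_active]

lemma isClosed_mem_active (a : Fin 3 → ℕ) : IsClosed {x | a ∈ f.active x} := by
  simp only [mem_active, IsMaxAt]
  by_cases ha : a ∈ f.support
  · simp only [ha, true_and, Set.ofPred_forall]
    exact isClosed_iInter fun b => isClosed_iInter fun _ =>
      isClosed_le (f.continuous_mono b) (f.continuous_mono a)
  · simp [ha]

lemma isClosed_subset_active (C : Finset (Fin 3 → ℕ)) : IsClosed {x | C ⊆ f.active x} := by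
  simp only [Finset.subset_iff, Set.ofPred_forall]
  exact isClosed_iInter fun a => isClosed_iInter fun _ => isClosed_mem_active a

lemma mem_active_combo {a : Fin 3 → ℕ} {x y : Space} (hx : a ∈ f.active x) (hy : a ∈ f.active y)
    {s t : ℝ} (hs : 0 ≤ s) (ht : 0 ≤ t) (hst : s + t = 1) : a ∈ f.active (s • x + t • y) := by
  refine mem_active.2 ⟨active_subset_support x hx, fun b hb => ?_⟩
  rw [mono_combo _ _ _ _ hst, mono_combo _ _ _ _ hst]
  exact add_le_add (mul_le_mul_of_nonneg_left (mono_le_of_mem_active hx hb) hs)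
    (mul_le_mul_of_nonneg_left (mono_le_of_mem_active hy hb) ht)

lemma eventually_active_subset (x : Space) : ∀ᶠ y in 𝓝 x, f.active y ⊆ f.active x := by
  have h : ∀ b ∈ f.support, ∀ᶠ y in 𝓝 x, b ∈ f.active y → b ∈ f.active x := by
    intro b hb
    by_cases hx : b ∈ f.active x
    · exact Filter.Eventually.of_forall fun _ _ => hx
    · filter_upwards [(isClosed_mem_active (f := f) b).isOpen_compl.mem_nhds hx] with y hy h
      exact absurd h hy
  filter_upwards [(Filter.eventually_all_finset _).2 h] with y hy b hb
  exact hy b (active_subset_support y hb) hb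

/-- Close to every point of `l` there is a point of `l` near which the active set is constant. -/
lemma exists_eventually_active_eq {T : Type*} [TopologicalSpace T] {g : T → Space}
    (hg : Continuous g) {l : Set T} {p : T} (hp : p ∈ l) :
    ∃ q ∈ l, f.active (g q) ⊆ f.active (g p) ∧
      ∀ᶠ q' in 𝓝[l] q, f.active (g q') = f.active (g q) := by
  have hev : ∀ q, ∀ᶠ q' in 𝓝 q, f.active (g q') ⊆ f.active (g q) := fun q =>
    hg.continuousAt.eventually (eventually_active_subset (g q))
  obtain ⟨U, hU, hUo, hpU⟩ := eventually_nhds_iff.1 (hev p)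
  -- Active sets can only shrink near a point, so a point of `l ∩ U` whose active set has minimal
  -- size has a locally constant active set.
  have hne : {n | ∃ q ∈ l ∩ U, (f.active (g q)).card = n}.Nonempty := ⟨_, p, ⟨hp, hpU⟩, rfl⟩
  obtain ⟨q, ⟨hql, hqU⟩, hq⟩ := Nat.sInf_mem hne
  refine ⟨q, hql, hU q hqU, ?_⟩
  filter_upwards [nhdsWithin_le_nhds (hev q), nhdsWithin_le_nhds (hUo.mem_nhds hqU),
    self_mem_nhdsWithin] with q' h1 h2 h3
  refine Finset.eq_of_subset_of_card_le h1 ?_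
  rw [hq]
  exact Nat.sInf_le ⟨q', ⟨h3, h2⟩, rfl⟩

/-! ### Cells -/

/-- A convex combination of lifted exponents that maximises the linear form `ψ` puts positive weight
only on exponents that maximise it, and `ψ` takes the value `f.mono a x` at the lift of `a`. -/
lemma image_topFace (x : Space) :
    Prod.fst '' f.topFace x = convexHull ℝ (expPoint '' (f.active x : Set (Fin 3 → ℕ))) := by
  classical
  set lift : (Fin 3 → ℕ) → Space × ℝ := fun a => (expPoint a, f.coeff a) with hlift
  set ψ : Space × ℝ →ₗ[ℝ] ℝ :=
    { toFun := fun z => x ⬝ᵥ z.1 + z.2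
      map_add' := fun z w => by simp only [Prod.fst_add, Prod.snd_add, dotProduct_add]; ring
      map_smul' := fun c z => by simp [dotProduct_smul, mul_add] } with hψ
  have hval : ∀ a, ψ (lift a) = f.mono a x := fun a => by
    simp only [hlift, hψ, mono, dotProduct_comm x, LinearMap.coe_mk, AddHom.coe_mk]; ring
  apply Set.Subset.antisymm
  · rintro _ ⟨z, ⟨hz, hmax⟩, rfl⟩
    obtain ⟨ι, _, w, y, hw0, hw1, hy, hyz⟩ := mem_convexHull_iff_exists_fintype.1 hz
    have hle : ∀ i, 0 ≤ w i * (ψ z - ψ (y i)) := fun i =>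
      mul_nonneg (hw0 i) (sub_nonneg.2 (hmax _ (subset_convexHull ℝ _ (hy i))))
    have hsum : ∑ i, w i * (ψ z - ψ (y i)) = 0 := by
      simp only [mul_sub, Finset.sum_sub_distrib, ← Finset.sum_mul, hw1, one_mul]
      conv_lhs => rw [← hyz]
      simp
    have hzero := (Finset.sum_eq_zero_iff_of_nonneg fun i _ => hle i).1 hsum
    have hz1 : z.1 = (Finset.univ.filter fun i => w i ≠ 0).centerMass w fun i => (y i).1 := by
      rw [Finset.centerMass_filter_ne_zero, Finset.centerMass_eq_of_sum_1 _ _ hw1, ← hyz]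
      simp [Prod.fst_sum]
    rw [hz1]
    refine Finset.centerMass_mem_convexHull _ (fun i _ => hw0 i) ?_ fun i hi => ?_
    · rw [Finset.sum_filter_ne_zero, hw1]; exact one_pos
    · obtain ⟨a, ha, hai⟩ := hy i
      have hi' := (Finset.mem_filter.1 hi).2
      have h2 : ψ z = ψ (lift a) := by
        have hai' : lift a = y i := hai
        rw [hai']
        exact sub_eq_zero.1 ((mul_eq_zero.1 (hzero i (Finset.mem_univ i))).resolve_left hi')
      refine ⟨a, mem_active.2 ⟨ha, fun b hb => ?_⟩, by rw [← hai]⟩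
      rw [← hval a, ← h2, ← hval b]
      exact hmax _ (subset_convexHull ℝ _ ⟨b, hb, rfl⟩)
  · apply convexHull_min
    · rintro _ ⟨a, ha, rfl⟩
      refine ⟨lift a, ⟨subset_convexHull ℝ _ ⟨a, active_subset_support x ha, rfl⟩, ?_⟩, rfl⟩
      intro w hw
      have hconv : Convex ℝ {w | ψ w ≤ ψ (lift a)} := convex_halfSpace_le ψ.isLinear _
      refine convexHull_min ?_ hconv hw
      rintro _ ⟨b, hb, rfl⟩
      change ψ (lift b) ≤ ψ (lift a)
      rw [hval, hval]
      exact mono_le_of_mem_active ha hb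
    · refine Convex.is_linear_image ?_ (LinearMap.fst ℝ Space ℝ).isLinear
      have : f.topFace x = f.liftedPolytope ∩ ⋂ w ∈ f.liftedPolytope, {z | ψ w ≤ ψ z} := by
        ext z; simp [topFace, hψ]
      rw [this]
      exact (convex_convexHull ℝ _).inter
        (convex_iInter₂ fun w _ => convex_halfSpace_ge ψ.isLinear _)

/-- The dual cell only tests vertices, while an active exponent need not be a vertex a priori. On
the exponents active at `x`, the difference of two monomials at `y` is a linear function of the
exponent; if it vanishes at the vertices, it vanishes on their hull, which is all of `D` by
Krein–Milman. -/
lemma dualCell_convexHull_active {x : Space} (hx : (f.active x).Nonempty) :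
    f.dualCell (convexHull ℝ (expPoint '' (f.active x : Set (Fin 3 → ℕ)))) =
      {y | f.active x ⊆ f.active y} := by
  set D := convexHull ℝ (expPoint '' (f.active x : Set (Fin 3 → ℕ))) with hD
  have hfin : (expPoint '' (f.active x : Set (Fin 3 → ℕ))).Finite := (Finset.finite_toSet _).image _
  have hext : D.extremePoints ℝ ⊆ expPoint '' (f.active x : Set (Fin 3 → ℕ)) :=
    extremePoints_convexHull_subset
  have hKM : D = convexHull ℝ (D.extremePoints ℝ) := by
    have h := closure_convexHull_extremePoints (hfin.isCompact_convexHull (𝕜 := ℝ))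
      (convex_convexHull ℝ (expPoint '' (f.active x : Set (Fin 3 → ℕ))))
    rw [← hD, ((hfin.subset hext).isClosed_convexHull (𝕜 := ℝ)).closure_eq] at h
    exact h.symm
  ext y
  constructor
  · intro hy a ha
    obtain ⟨e, he⟩ : (D.extremePoints ℝ).Nonempty := by
      by_contra h
      rw [Set.not_nonempty_iff_eq_empty] at h
      rw [h, convexHull_empty, hD, convexHull_eq_empty, Set.image_eq_empty] at hKM
      exact hx.ne_empty (by simpa using hKM)
    obtain ⟨b, hb, rfl⟩ := hext he
    have hby : b ∈ f.active y := mem_active.2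
      ⟨active_subset_support x hb, hy b (active_subset_support x hb) he⟩
    have hmono : ∀ c, c ∈ f.active x →
        f.mono c y - f.mono b y = expPoint c ⬝ᵥ (y - x) - expPoint b ⬝ᵥ (y - x) := by
      intro c hc
      have h1 := mono_eq_of_mem_active hc hb
      have h2 := f.mono_add c x (y - x)
      have h3 := f.mono_add b x (y - x)
      rw [add_sub_cancel] at h2 h3
      linarith
    have hlin : IsLinearMap ℝ fun z : Space => z ⬝ᵥ (y - x) :=
      ⟨fun _ _ => add_dotProduct _ _ _, fun _ _ => smul_dotProduct _ _ _⟩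
    have hsub : D ⊆ {z | z ⬝ᵥ (y - x) = expPoint b ⬝ᵥ (y - x)} := by
      rw [hKM]
      refine convexHull_min ?_ (convex_hyperplane hlin _)
      intro z hz
      obtain ⟨c, hc, rfl⟩ := hext hz
      have hcs := active_subset_support x hc
      have hcy : c ∈ f.active y := mem_active.2 ⟨hcs, hy c hcs hz⟩
      have := hmono c hc
      rw [mono_eq_of_mem_active hcy hby, sub_self] at this
      exact (sub_eq_zero.1 this.symm)
    have ha' : expPoint a ⬝ᵥ (y - x) = expPoint b ⬝ᵥ (y - x) :=
      hsub (subset_convexHull ℝ _ ⟨a, ha, rfl⟩)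
    refine mem_active_of_mono_eq hby (active_subset_support x ha) ?_
    have := hmono a ha
    linarith
  · intro hy a _ ha b hb
    obtain ⟨c, hc, hca⟩ := hext ha
    obtain rfl := expPoint_injective hca
    exact mono_le_of_mem_active (hy hc) hb

lemma minCell_eq {p : Space} (hp : p ∈ f.surface) :
    f.minCell p = {y | f.active p ⊆ f.active y} := by
  obtain ⟨a, b, hab, ha, hb⟩ := mem_surface_iff.1 hp
  apply Set.Subset.antisymm
  · refine Set.sInter_subset_of_mem ⟨⟨_, ⟨p, rfl⟩, ?_, ?_⟩, Finset.Subset.refl _⟩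
    · rw [image_topFace]
      exact ⟨_, subset_convexHull ℝ _ ⟨a, ha, rfl⟩, _, subset_convexHull ℝ _ ⟨b, hb, rfl⟩,
        expPoint_injective.ne hab⟩
    · rw [image_topFace, dualCell_convexHull_active ⟨a, ha⟩]
  · rintro y hy _ ⟨⟨_, ⟨x, rfl⟩, hD, rfl⟩, hpC⟩
    have hx := active_nonempty ⟨a, active_subset_support p ha⟩ x
    rw [image_topFace, dualCell_convexHull_active hx] at hpC ⊢
    exact Finset.Subset.trans hpC hy

lemma minCell_eq_iff {p q : Space} (hp : p ∈ f.surface) (hq : q ∈ f.surface) :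
    f.minCell p = f.minCell q ↔ f.active p = f.active q := by
  rw [minCell_eq hp, minCell_eq hq]
  refine ⟨fun h => ?_, fun h => by rw [h]⟩
  have h1 : q ∈ {y | f.active p ⊆ f.active y} := by rw [h]; exact Finset.Subset.refl _
  have h2 : p ∈ {y | f.active q ⊆ f.active y} := by rw [← h]; exact Finset.Subset.refl _
  exact Finset.Subset.antisymm h1 h2

/-- The active sets at the points of `l` near which the active set is constant along `l`. -/
def genericSets (f : TropPoly) (l : Set Space) : Set (Finset (Fin 3 → ℕ)) :=
  {C | ∃ q ∈ l, C = f.active q ∧ ∀ᶠ q' in 𝓝[l] q, f.active q' = C}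

/-- Translates equality of the geometric data into active sets, the only form in which it is used
later. -/
lemma genericSets_subset_of_cellsThrough_eq {l l' : Set Space} (hl : l ⊆ f.surface)
    (hl' : l' ⊆ f.surface) (h : f.cellsThrough l = f.cellsThrough l') :
    f.genericSets l ⊆ f.genericSets l' := by
  rintro C ⟨q, hq, rfl, hev⟩
  have hmem : f.minCell q ∈ f.cellsThrough l := by
    refine ⟨q, hq, rfl, ?_⟩
    filter_upwards [hev, self_mem_nhdsWithin] with q' h1 h2
    exact (minCell_eq_iff (hl h2) (hl hq)).2 h1
  rw [h] at hmem
  obtain ⟨r, hr, hrq, hev'⟩ := hmem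
  have hqr := (minCell_eq_iff (hl hq) (hl' hr)).1 hrq
  refine ⟨r, hr, hqr, ?_⟩
  filter_upwards [hev', self_mem_nhdsWithin] with r' h1 h2
  rw [hqr]
  exact (minCell_eq_iff (hl' h2) (hl' hr)).1 h1

lemma exists_genericSet_subset {l : Set Space} {p : Space} (hp : p ∈ l) :
    ∃ C ∈ f.genericSets l, C ⊆ f.active p := by
  obtain ⟨q, hq, hqp, hev⟩ := exists_eventually_active_eq (f := f) continuous_id hp
  exact ⟨_, ⟨q, hq, rfl, hev⟩, hqp⟩

lemma finite_genericSets (l : Set Space) : (f.genericSets l).Finite := by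
  refine (Finset.finite_toSet f.support.powerset).subset ?_
  rintro C ⟨q, _, rfl, _⟩
  exact Finset.mem_coe.2 (Finset.mem_powerset.2 (active_subset_support q))

end TropPoly

/-! ### Smoothness -/

/-- Four lattice points spanning an elementary tetrahedron. -/
def IsUnimodular (v : Fin 4 → Fin 3 → ℤ) : Prop :=
  |(Matrix.of fun i k : Fin 3 => v i.succ k - v 0 k).det| = 1

namespace IsUnimodular

variable {v : Fin 4 → Fin 3 → ℤ}

lemma isUnit_det (hv : IsUnimodular v) :
    IsUnit (Matrix.of fun i k : Fin 3 => v i.succ k - v 0 k).det := by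
  rw [Int.isUnit_iff]
  exact (abs_eq zero_le_one).1 hv

/-- The vertices span the lattice. -/
lemma exists_int_combination (hv : IsUnimodular v) (z : Fin 3 → ℤ) :
    ∃ c : Fin 3 → ℤ, ∀ k, z k = ∑ i, c i * (v i.succ k - v 0 k) := by
  set N := Matrix.of fun i k : Fin 3 => v i.succ k - v 0 k with hN
  refine ⟨Matrix.vecMul z N⁻¹, fun k => ?_⟩
  have h : Matrix.vecMul (Matrix.vecMul z N⁻¹) N = z := by
    rw [Matrix.vecMul_vecMul, Matrix.nonsing_inv_mul N hv.isUnit_det, Matrix.vecMul_one]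
  conv_lhs => rw [← h]
  rfl

/-- Affine functions with prescribed values at the vertices. -/
lemma exists_affine (hv : IsUnimodular v) (h : Fin 4 → ℝ) :
    ∃ u : Space, ∀ i, intVec (v i) ⬝ᵥ u - intVec (v 0) ⬝ᵥ u = h i - h 0 := by
  set N := Matrix.of fun i k : Fin 3 => v i.succ k - v 0 k with hN
  set M : Matrix (Fin 3) (Fin 3) ℝ := N.map (Int.castRingHom ℝ) with hM
  have hdet : IsUnit M.det := by
    have := hv.isUnit_det.map (Int.castRingHom ℝ)
    rwa [RingHom.map_det] at this
  refine ⟨M⁻¹.mulVec fun i => h i.succ - h 0, fun i => ?_⟩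
  have hmul : M.mulVec (M⁻¹.mulVec fun i => h i.succ - h 0) = fun i => h i.succ - h 0 := by
    rw [Matrix.mulVec_mulVec, Matrix.mul_nonsing_inv M hdet, Matrix.one_mulVec]
  refine Fin.cases (by simp) (fun j => ?_) i
  have := congrFun hmul j
  rw [← this, ← sub_dotProduct]
  simp only [Matrix.mulVec]
  congr 1
  ext k
  simp [hM, hN, intVec]

/-- A linear form that is constant on the vertices vanishes. -/
lemma eq_zero_of_const (hv : IsUnimodular v) {w : Space}
    (h : ∀ i, intVec (v i) ⬝ᵥ w = intVec (v 0) ⬝ᵥ w) : w = 0 := by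
  set N := Matrix.of fun i k : Fin 3 => v i.succ k - v 0 k with hN
  set M : Matrix (Fin 3) (Fin 3) ℝ := N.map (Int.castRingHom ℝ) with hM
  have hdet : IsUnit M.det := by
    have := hv.isUnit_det.map (Int.castRingHom ℝ)
    rwa [RingHom.map_det] at this
  have hmul : M.mulVec w = 0 := by
    ext j
    have := sub_eq_zero.2 (h j.succ)
    rw [← sub_dotProduct] at this
    rw [Pi.zero_apply, ← this]
    simp only [Matrix.mulVec]
    congr 1
    ext k
    simp [hM, hN, intVec]
  rw [← Matrix.one_mulVec w, ← Matrix.nonsing_inv_mul M hdet, ← Matrix.mulVec_mulVec, hmul,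
    Matrix.mulVec_zero]

/-- The only lattice points of an elementary tetrahedron are its vertices. -/
lemma exists_eq_of_mem_convexHull (hv : IsUnimodular v) {a : Fin 3 → ℤ}
    (ha : intVec a ∈ convexHull ℝ (Set.range fun i => intVec (v i))) : ∃ i, a = v i := by
  obtain ⟨c, hc⟩ := hv.exists_int_combination (a - v 0)
  -- An affine function with values in `[0, 1]` at the vertices has values in `[0, 1]` at `a`.
  -- Applied to the barycentric coordinates and to their sum, this bounds the integers `c j` and `∑
  -- c j`.
  have hval : ∀ h : Fin 4 → ℝ, h 0 = 0 → (∀ i, 0 ≤ h i ∧ h i ≤ 1) →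
      0 ≤ ∑ j, (c j : ℝ) * h j.succ ∧ ∑ j, (c j : ℝ) * h j.succ ≤ 1 := by
    intro h h0 h1
    obtain ⟨u, hu⟩ := hv.exists_affine h
    have hlin : IsLinearMap ℝ fun z : Space => z ⬝ᵥ u :=
      ⟨fun _ _ => add_dotProduct _ _ _, fun _ _ => smul_dotProduct _ _ _⟩
    have hsum : ∑ j, (c j : ℝ) * h j.succ = intVec a ⬝ᵥ u - intVec (v 0) ⬝ᵥ u := by
      have : intVec a - intVec (v 0) = ∑ j, (c j : ℝ) • (intVec (v j.succ) - intVec (v 0)) := by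
        ext k
        have := hc k
        simp only [Pi.sub_apply] at this
        simp only [intVec, Pi.sub_apply, Finset.sum_apply, Pi.smul_apply, smul_eq_mul]
        exact_mod_cast this
      rw [← sub_dotProduct, this, sum_dotProduct]
      refine Finset.sum_congr rfl fun j _ => ?_
      rw [smul_dotProduct, sub_dotProduct, hu, h0, sub_zero, smul_eq_mul]
    have hlo : convexHull ℝ (Set.range fun i => intVec (v i)) ⊆
        {z | intVec (v 0) ⬝ᵥ u ≤ z ⬝ᵥ u} := by
      refine convexHull_min ?_ (convex_halfSpace_ge hlin _)
      rintro _ ⟨i, rfl⟩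
      have := hu i
      have := (h1 i).1
      simp only [Set.mem_ofPred_eq]
      linarith
    have hhi : convexHull ℝ (Set.range fun i => intVec (v i)) ⊆
        {z | z ⬝ᵥ u ≤ intVec (v 0) ⬝ᵥ u + 1} := by
      refine convexHull_min ?_ (convex_halfSpace_le hlin _)
      rintro _ ⟨i, rfl⟩
      have := hu i
      have := (h1 i).2
      simp only [Set.mem_ofPred_eq]
      linarith
    have h2 := hlo ha
    have h3 := hhi ha
    simp only [Set.mem_ofPred_eq] at h2 h3
    rw [hsum]
    constructor <;> linarith
  have hc01 : ∀ j, 0 ≤ c j ∧ c j ≤ 1 := by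
    intro j
    have := hval (fun i => if i = j.succ then 1 else 0) (by simp [(Fin.succ_ne_zero j).symm])
      fun i => by split_ifs <;> norm_num
    simp only [Fin.succ_inj, mul_ite, mul_one, mul_zero, Finset.sum_ite_eq', Finset.mem_univ,
      if_true] at this
    exact_mod_cast this
  have hcs : ∑ j, c j ≤ 1 := by
    have := (hval (fun i => if i = 0 then 0 else 1) (by simp)
      fun i => by split_ifs <;> norm_num).2
    simp only [Fin.succ_ne_zero, if_false, mul_one] at this
    exact_mod_cast this
  rw [Fin.sum_univ_three] at hcs
  simp only [Fin.sum_univ_three, Pi.sub_apply] at hc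
  have h0 := hc01 0
  have h1 := hc01 1
  have h2 := hc01 2
  have hcases : (c 0 = 0 ∧ c 1 = 0 ∧ c 2 = 0) ∨ (c 0 = 1 ∧ c 1 = 0 ∧ c 2 = 0) ∨
      (c 0 = 0 ∧ c 1 = 1 ∧ c 2 = 0) ∨ (c 0 = 0 ∧ c 1 = 0 ∧ c 2 = 1) := by omega
  rcases hcases with ⟨e0, e1, e2⟩ | ⟨e0, e1, e2⟩ | ⟨e0, e1, e2⟩ | ⟨e0, e1, e2⟩ <;>
    simp only [e0, e1, e2] at hc
  · exact ⟨0, funext fun k => by linarith [hc k]⟩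
  · exact ⟨(0 : Fin 3).succ, funext fun k => by linarith [hc k]⟩
  · exact ⟨(1 : Fin 3).succ, funext fun k => by linarith [hc k]⟩
  · exact ⟨(2 : Fin 3).succ, funext fun k => by linarith [hc k]⟩

end IsUnimodular

/-- The exponent vector as an integer vector. -/
def toInt (a : Fin 3 → ℕ) : Fin 3 → ℤ := fun k => a k

lemma intVec_toInt (a : Fin 3 → ℕ) : intVec (toInt a) = expPoint a := by
  ext k; simp [intVec, toInt, expPoint]

lemma toInt_injective : Function.Injective toInt := fun a b h => by
  funext k
  have := congrFun h k
  simpa [toInt] using this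

/-- There are finitely many cells, so the one spanned by the active exponents lies in a maximal one,
an elementary tetrahedron whose only lattice points are its vertices. -/
lemma TropPoly.IsSmooth.exists_isUnimodular {f : TropPoly} (hf : f.IsSmooth) (x : Space) :
    ∃ v : Fin 4 → Fin 3 → ℤ, IsUnimodular v ∧ ∀ a ∈ f.active x, ∃ i, toInt a = v i := by
  have hfin : f.subdiv.Finite := by
    refine ((Finset.finite_toSet f.support.powerset).image fun C : Finset (Fin 3 → ℕ) =>
      convexHull ℝ (expPoint '' (C : Set (Fin 3 → ℕ)))).subset ?_
    rintro D ⟨y, rfl⟩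
    exact ⟨f.active y, Finset.mem_coe.2 (Finset.mem_powerset.2 (active_subset_support y)),
      (image_topFace y).symm⟩
  obtain ⟨D, hle, hD⟩ := hfin.exists_le_maximal ⟨x, rfl⟩
  obtain ⟨v, hDv, hv⟩ := hf D hD
  refine ⟨v, hv, fun a ha => IsUnimodular.exists_eq_of_mem_convexHull hv ?_⟩
  change D = convexHull ℝ (Set.range fun i => intVec (v i)) at hDv
  rw [← hDv, intVec_toInt]
  apply hle
  rw [image_topFace]
  exact subset_convexHull ℝ _ ⟨a, ha, rfl⟩

end TropGeom

namespace TropGeom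
namespace TropPoly

variable {f : TropPoly}

/-! ### Interpolation of parallel segments and rays -/

/-- Slopes of active monomials increase along a line. -/
lemma slope_mono {p d : Space} {a b : Fin 3 → ℕ} {x y : ℝ} (hxy : x < y)
    (ha : a ∈ f.active (p + x • d)) (hb : b ∈ f.active (p + y • d)) :
    expPoint a ⬝ᵥ d ≤ expPoint b ⬝ᵥ d := by
  have h1 := mono_le_of_mem_active ha (active_subset_support _ hb)
  have h2 := mono_le_of_mem_active hb (active_subset_support _ ha)
  rw [mono_add_smul, mono_add_smul] at h1 h2
  nlinarith

/-- A monomial that is active somewhere on a line is active wherever its slope is between the slopes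
of two active monomials. -/
lemma mem_active_of_slope_between {p d : Space} {a b e : Fin 3 → ℕ} {x y : ℝ}
    (ha : a ∈ f.active (p + x • d)) (hb : b ∈ f.active (p + x • d))
    (he : e ∈ f.active (p + y • d)) (hae : expPoint a ⬝ᵥ d ≤ expPoint e ⬝ᵥ d)
    (heb : expPoint e ⬝ᵥ d ≤ expPoint b ⬝ᵥ d) : e ∈ f.active (p + x • d) := by
  have hes := active_subset_support _ he
  have hab := mono_eq_of_mem_active ha hb
  have h1 := mono_le_of_mem_active he (active_subset_support _ ha)
  have h2 := mono_le_of_mem_active he (active_subset_support _ hb)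
  have h3 := mono_le_of_mem_active ha hes
  rw [mono_add_smul, mono_add_smul] at h1 h2 h3 hab
  refine mem_active_of_mono_eq ha hes ?_
  rw [mono_add_smul, mono_add_smul]
  rcases le_total x y with h | h <;> nlinarith

/-- Monomials that agree at two distinct points of a line have the same slope along it.
Nontriviality of `J` provides the second point. -/
lemma exists_slope_of_genericSets {p d : Space} {J : Set ℝ} (hJ : Convex ℝ J)
    (hJn : J.Nontrivial) {C : Finset (Fin 3 → ℕ)}
    (hC : C ∈ f.genericSets ((fun s : ℝ => p + s • d) '' J)) :
    ∃ σ : ℝ, ∀ a ∈ C, expPoint a ⬝ᵥ d = σ := by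
  obtain ⟨_, ⟨x, hx, rfl⟩, rfl, hev⟩ := hC
  obtain ⟨y, hy, hyx⟩ := hJn.exists_ne x
  have htend : Filter.Tendsto (fun ε : ℝ => p + (x + ε * (y - x)) • d) (𝓝[Set.Ioc 0 1] 0)
      (𝓝[(fun s : ℝ => p + s • d) '' J] (p + x • d)) := by
    refine tendsto_nhdsWithin_iff.2 ⟨?_, ?_⟩
    · have : Continuous fun ε : ℝ => p + (x + ε * (y - x)) • d := by fun_prop
      have := this.tendsto 0
      simp only [zero_mul, add_zero] at this
      exact this.mono_left nhdsWithin_le_nhds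
    · filter_upwards [self_mem_nhdsWithin] with ε hε
      refine ⟨_, ?_, rfl⟩
      have := hJ hx hy (sub_nonneg.2 hε.2) hε.1.le (by ring)
      simp only [smul_eq_mul] at this
      convert this using 1
      ring
  have hne : (𝓝[Set.Ioc (0 : ℝ) 1] 0).NeBot := by
    rw [nhdsWithin_Ioc_eq_nhdsGT zero_lt_one]; infer_instance
  obtain ⟨ε, hε1, hε2⟩ := ((htend.eventually hev).and self_mem_nhdsWithin).exists
  have hkey : ∀ a ∈ f.active (p + x • d), ∀ b ∈ f.active (p + x • d),
      expPoint a ⬝ᵥ d = expPoint b ⬝ᵥ d := by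
    intro a ha b hb
    have h1 := mono_eq_of_mem_active ha hb
    rw [← hε1] at ha hb
    have h2 := mono_eq_of_mem_active ha hb
    rw [mono_add_smul, mono_add_smul] at h1 h2
    have h3 : ε * (y - x) ≠ 0 := mul_ne_zero hε2.1.ne' (sub_ne_zero.2 hyx)
    have h4 : ε * (y - x) * (expPoint a ⬝ᵥ d - expPoint b ⬝ᵥ d) = 0 := by linarith
    exact sub_eq_zero.1 ((mul_eq_zero.1 h4).resolve_left h3)
  rcases (f.active (p + x • d)).eq_empty_or_nonempty with h | ⟨b, hb⟩
  · exact ⟨0, fun a ha => by simp [h] at ha⟩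
  · exact ⟨_, fun a ha => hkey a ha b hb⟩

/-- Slide the first point backwards and the second forwards, keeping the weighted mean of the
parameters. By convexity of `f`, the slope at the first point decreases and that at the second
increases. They start in the order `σ C' < σ C` and are reversed once one point reaches the set
found at the other, so in between they cross, and there a common generic set is active at both
points. -/
lemma exists_common_genericSet_aux {p p' d : Space} {J J' : Set ℝ} (hJ : Convex ℝ J)
    (hJ' : Convex ℝ J') (hne : f.support.Nonempty)
    (h : f.genericSets ((fun s : ℝ => p + s • d) '' J) =
      f.genericSets ((fun s : ℝ => p' + s • d) '' J'))
    {t t' : ℝ} (ht : 0 < t) (ht' : 0 < t') {s s' : ℝ} (hs : s ∈ J) (hs' : s' ∈ J')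
    (σ : Finset (Fin 3 → ℕ) → ℝ)
    (hσ : ∀ C ∈ f.genericSets ((fun s : ℝ => p + s • d) '' J), ∀ a ∈ C, expPoint a ⬝ᵥ d = σ C)
    {C C' : Finset (Fin 3 → ℕ)} (hC : C ∈ f.genericSets ((fun s : ℝ => p + s • d) '' J))
    (hC' : C' ∈ f.genericSets ((fun s : ℝ => p + s • d) '' J))
    (hCs : C ⊆ f.active (p + s • d)) (hCs' : C' ⊆ f.active (p' + s' • d)) (hlt : σ C' < σ C) :
    ∃ E ∈ f.genericSets ((fun s : ℝ => p + s • d) '' J), ∃ x ∈ J, ∃ x' ∈ J',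
      t * x + t' * x' = t * s + t' * s' ∧ E ⊆ f.active (p + x • d) ∧ E ⊆ f.active (p' + x' • d) := by
  set G := f.genericSets ((fun s : ℝ => p + s • d) '' J) with hG
  have hGne : ∀ E ∈ G, E.Nonempty := by
    rintro E ⟨q, _, rfl, _⟩; exact active_nonempty hne q
  -- slopes along the two pieces
  have hmono : ∀ {q : Space} {E F : Finset (Fin 3 → ℕ)} {x y : ℝ}, E ∈ G → F ∈ G → x < y →
      E ⊆ f.active (q + x • d) → F ⊆ f.active (q + y • d) → σ E ≤ σ F := by
    intro q E F x y hE hF hxy hEx hFy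
    obtain ⟨a, ha⟩ := hGne E hE
    obtain ⟨b, hb⟩ := hGne F hF
    rw [← hσ E hE a ha, ← hσ F hF b hb]
    exact slope_mono hxy (hEx ha) (hFy hb)
  have hbetween : ∀ {q : Space} {A B E : Finset (Fin 3 → ℕ)} {x y : ℝ}, A ∈ G → B ∈ G → E ∈ G →
      A ⊆ f.active (q + x • d) → B ⊆ f.active (q + x • d) → E ⊆ f.active (q + y • d) →
      σ A ≤ σ E → σ E ≤ σ B → E ⊆ f.active (q + x • d) := by
    intro q A B E x y hA hB hE hAx hBx hEy h1 h2 e he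
    obtain ⟨a, ha⟩ := hGne A hA
    obtain ⟨b, hb⟩ := hGne B hB
    rw [← hσ A hA a ha, ← hσ E hE e he] at h1
    rw [← hσ B hB b hb, ← hσ E hE e he] at h2
    exact mem_active_of_slope_between (hAx ha) (hBx hb) (hEy he) h1 h2
  have hwit : ∀ E ∈ G, ∃ y ∈ J, E ⊆ f.active (p + y • d) := by
    rintro E ⟨_, ⟨y, hy, rfl⟩, rfl, _⟩; exact ⟨y, hy, Finset.Subset.refl _⟩
  have hwit' : ∀ E ∈ G, ∃ y ∈ J', E ⊆ f.active (p' + y • d) := by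
    rw [h]
    rintro E ⟨_, ⟨y, hy, rfl⟩, rfl, _⟩; exact ⟨y, hy, Finset.Subset.refl _⟩
  have hcov : ∀ y ∈ J, ∃ E ∈ G, E ⊆ f.active (p + y • d) := fun y hy =>
    exists_genericSet_subset ⟨y, hy, rfl⟩
  have hcov' : ∀ y ∈ J', ∃ E ∈ G, E ⊆ f.active (p' + y • d) := by
    rw [h]; exact fun y hy => exists_genericSet_subset ⟨y, hy, rfl⟩
  obtain ⟨r, hr, hrC'⟩ := hwit C' hC'
  obtain ⟨r', hr', hrC⟩ := hwit' C hC
  have hrs : r ≤ s := by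
    by_contra! hlt'
    exact absurd (hmono hC hC' hlt' hCs hrC') (not_le.2 hlt)
  have hrs' : s' ≤ r' := by
    by_contra! hlt'
    exact absurd (hmono hC hC' hlt' hrC hCs') (not_le.2 hlt)
  -- the path
  set X := min ((s - r) / t') ((r' - s') / t) with hX
  have hX0 : 0 ≤ X := le_min (div_nonneg (sub_nonneg.2 hrs) ht'.le)
    (div_nonneg (sub_nonneg.2 hrs') ht.le)
  have hJx : ∀ x ∈ Set.Icc 0 X, s - t' * x ∈ J := by
    intro x hx
    have h1 : x ≤ (s - r) / t' := hx.2.trans (min_le_left _ _)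
    rw [le_div_iff₀ ht'] at h1
    exact hJ.ordConnected.out hr hs ⟨by linarith, by nlinarith [hx.1]⟩
  have hJx' : ∀ x ∈ Set.Icc 0 X, s' + t * x ∈ J' := by
    intro x hx
    have h1 : x ≤ (r' - s') / t := hx.2.trans (min_le_right _ _)
    rw [le_div_iff₀ ht] at h1
    exact hJ'.ordConnected.out hs' hr' ⟨by nlinarith [hx.1], by linarith⟩
  have hGfin : G.Finite := finite_genericSets _
  have hclosed : ∀ P : Finset (Fin 3 → ℕ) × Finset (Fin 3 → ℕ) → Prop,
      IsClosed (⋃ E ∈ {E ∈ G ×ˢ G | P E}, {x : ℝ | E.1 ⊆ f.active (p + (s - t' * x) • d) ∧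
        E.2 ⊆ f.active (p' + (s' + t * x) • d)}) := by
    intro P
    refine ((hGfin.prod hGfin).subset fun _ hE => hE.1).isClosed_biUnion fun E _ => ?_
    exact ((isClosed_subset_active E.1).preimage (by fun_prop)).inter
      ((isClosed_subset_active E.2).preimage (by fun_prop))
  -- The interval is covered by the closed sets where the slopes can be ordered one way or the
  -- other; connectedness gives a parameter with both orders.
  have hpre := isPreconnected_closed_iff.1 (isPreconnected_Icc (a := (0 : ℝ)) (b := X)) _ _
    (hclosed fun E => σ E.2 ≤ σ E.1) (hclosed fun E => σ E.1 ≤ σ E.2) ?_ ?_ ?_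
  · obtain ⟨x, hx, hxA, hxB⟩ := hpre
    simp only [Set.mem_iUnion] at hxA hxB
    obtain ⟨⟨A, A'⟩, ⟨⟨hA, hA'⟩, hAA⟩, hAx, hAx'⟩ := hxA
    obtain ⟨⟨B, B'⟩, ⟨⟨hB, hB'⟩, hBB⟩, hBx, hBx'⟩ := hxB
    dsimp only at *
    -- At the crossing, one of the available sets has its slope between two slopes active on the
    -- other line. Lying in `G`, it is active somewhere on that line, hence also at the crossing
    -- point.
    have key : ∃ E ∈ G, E ⊆ f.active (p + (s - t' * x) • d) ∧
        E ⊆ f.active (p' + (s' + t * x) • d) := by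
      obtain ⟨_, _, hA'w⟩ := hwit A' hA'
      obtain ⟨_, _, hAw⟩ := hwit' A hA
      obtain ⟨_, _, hBw⟩ := hwit' B hB
      rcases le_total (σ B) (σ A) with h1 | h1
      · rcases le_total (σ B) (σ A') with h2 | h2
        · exact ⟨A', hA', hbetween hB hA hA' hBx hAx hA'w h2 hAA, hAx'⟩
        · exact ⟨B, hB, hBx, hbetween hA' hB' hB hAx' hBx' hBw h2 hBB⟩
      · exact ⟨A, hA, hAx, hbetween hA' hB' hA hAx' hBx' hAw hAA (h1.trans hBB)⟩
    obtain ⟨E, hE, hEx, hEx'⟩ := key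
    exact ⟨E, hE, _, hJx x hx, _, hJx' x hx, by ring, hEx, hEx'⟩
  · intro x hx
    obtain ⟨E, hE, hEx⟩ := hcov _ (hJx x hx)
    obtain ⟨E', hE', hEx'⟩ := hcov' _ (hJx' x hx)
    rcases le_total (σ E') (σ E) with h1 | h1
    · exact Or.inl (Set.mem_biUnion (x := (E, E')) ⟨⟨hE, hE'⟩, h1⟩ ⟨hEx, hEx'⟩)
    · exact Or.inr (Set.mem_biUnion (x := (E, E')) ⟨⟨hE, hE'⟩, h1⟩ ⟨hEx, hEx'⟩)
  · refine ⟨0, ⟨le_rfl, hX0⟩, Set.mem_biUnion (x := (C, C')) ⟨⟨hC, hC'⟩, hlt.le⟩ ⟨?_, ?_⟩⟩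
    · simpa using hCs
    · simpa using hCs'
  · refine ⟨X, ⟨hX0, le_rfl⟩, ?_⟩
    have hXm : X ∈ Set.Icc 0 X := ⟨hX0, le_rfl⟩
    rcases le_total ((s - r) / t') ((r' - s') / t) with h1 | h1
    · have hXe : X = (s - r) / t' := min_eq_left h1
      have hx1 : s - t' * X = r := by rw [hXe]; field_simp; ring
      have hex : ∃ D' ∈ G, D' ⊆ f.active (p' + (s' + t * X) • d) ∧ σ C' ≤ σ D' := by
        rcases hX0.eq_or_lt with h0 | h0
        · exact ⟨C', hC', by rw [← h0]; simpa using hCs', le_rfl⟩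
        · obtain ⟨D', hD', hDx'⟩ := hcov' _ (hJx' X hXm)
          exact ⟨D', hD', hDx', hmono hC' hD' (by nlinarith) hCs' hDx'⟩
      obtain ⟨D', hD', hDx', hle⟩ := hex
      exact Set.mem_biUnion (x := (C', D')) ⟨⟨hC', hD'⟩, hle⟩ ⟨by rw [hx1]; exact hrC', hDx'⟩
    · have hXe : X = (r' - s') / t := min_eq_right h1
      have hx1 : s' + t * X = r' := by rw [hXe]; field_simp; ring
      have hex : ∃ D ∈ G, D ⊆ f.active (p + (s - t' * X) • d) ∧ σ D ≤ σ C := by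
        rcases hX0.eq_or_lt with h0 | h0
        · exact ⟨C, hC, by rw [← h0]; simpa using hCs, le_rfl⟩
        · obtain ⟨D, hD, hDx⟩ := hcov _ (hJx X hXm)
          exact ⟨D, hD, hDx, hmono hD hC (by nlinarith) hDx hCs⟩
      obtain ⟨D, hD, hDx, hle⟩ := hex
      exact Set.mem_biUnion (x := (D, C)) ⟨⟨hD, hC⟩, hle⟩ ⟨hDx, by rw [hx1]; exact hrC⟩

/-- Two parallel segments or rays in the surface with the same generic active sets can be
interpolated within the surface. -/
lemma interpolate_mem_surface {p p' d : Space} {J J' : Set ℝ} (hJ : Convex ℝ J)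
    (hJ' : Convex ℝ J') (hJn : J.Nontrivial)
    (hl : (fun s : ℝ => p + s • d) '' J ⊆ f.surface)
    (h : f.genericSets ((fun s : ℝ => p + s • d) '' J) =
      f.genericSets ((fun s : ℝ => p' + s • d) '' J'))
    {t t' : ℝ} (ht : 0 < t) (ht' : 0 < t') (htt : t + t' = 1) {s s' : ℝ} (hs : s ∈ J)
    (hs' : s' ∈ J') : t • (p + s • d) + t' • (p' + s' • d) ∈ f.surface := by
  have hne : f.support.Nonempty := by
    obtain ⟨a, _, _, ha, _⟩ := hl ⟨s, hs, rfl⟩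
    exact ⟨a, ha.1⟩
  set G := f.genericSets ((fun s : ℝ => p + s • d) '' J) with hG
  have hσ : ∃ σ : Finset (Fin 3 → ℕ) → ℝ, ∀ C ∈ G, ∀ a ∈ C, expPoint a ⬝ᵥ d = σ C := by
    have : ∀ C, ∃ σ : ℝ, C ∈ G → ∀ a ∈ C, expPoint a ⬝ᵥ d = σ := by
      intro C
      by_cases hC : C ∈ G
      · obtain ⟨σ, hσ⟩ := exists_slope_of_genericSets hJ hJn hC
        exact ⟨σ, fun _ => hσ⟩
      · exact ⟨0, fun h => absurd h hC⟩
    choose σ hσ using this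
    exact ⟨σ, hσ⟩
  obtain ⟨σ, hσ⟩ := hσ
  have key : ∃ E ∈ G, ∃ x ∈ J, ∃ x' ∈ J', t * x + t' * x' = t * s + t' * s' ∧
      E ⊆ f.active (p + x • d) ∧ E ⊆ f.active (p' + x' • d) := by
    obtain ⟨C, hC, hCs⟩ : ∃ C ∈ G, C ⊆ f.active (p + s • d) :=
      exists_genericSet_subset ⟨s, hs, rfl⟩
    obtain ⟨C', hC', hCs'⟩ : ∃ C' ∈ G, C' ⊆ f.active (p' + s' • d) := by
      rw [h]; exact exists_genericSet_subset ⟨s', hs', rfl⟩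
    rcases lt_trichotomy (σ C') (σ C) with hlt | heq | hlt
    · exact exists_common_genericSet_aux hJ hJ' hne h ht ht' hs hs' σ hσ hC hC' hCs hCs' hlt
    -- With equal slopes no sliding is needed: `C'` occurs somewhere on the first line and has the
    -- slope of `C`, so it is already active at `s`.
    · obtain ⟨_, ⟨y, hy, rfl⟩, rfl, _⟩ := id hC'
      refine ⟨_, hC', s, hs, s', hs', rfl, fun e he => ?_, hCs'⟩
      obtain ⟨a, ha⟩ : C.Nonempty := by
        obtain ⟨q, _, rfl, _⟩ := hC; exact active_nonempty hne q
      have h1 : expPoint a ⬝ᵥ d = expPoint e ⬝ᵥ d := by rw [hσ C hC a ha, hσ _ hC' e he, heq]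
      exact mem_active_of_slope_between (hCs ha) (hCs ha) he h1.le h1.ge
    · obtain ⟨E, hE, x, hx, x', hx', hxx, h1, h2⟩ := exists_common_genericSet_aux hJ' hJ hne
        h.symm ht' ht hs' hs σ (by rw [← h]; exact hσ) (by rw [← h]; exact hC')
        (by rw [← h]; exact hC) hCs' hCs hlt
      exact ⟨E, by rw [h]; exact hE, x', hx', x, hx, by linarith, h2, h1⟩
  obtain ⟨E, ⟨q, hq, rfl, -⟩, x, hx, x', hx', hxx, h1, h2⟩ := key
  obtain ⟨a, b, hab, ha, hb⟩ := mem_surface_iff.1 (hl hq)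
  have heq : t • (p + s • d) + t' • (p' + s' • d) = t • (p + x • d) + t' • (p' + x' • d) := by
    ext k
    simp only [Pi.add_apply, Pi.smul_apply, smul_eq_mul]
    linear_combination (-d k) * hxx
  rw [heq]
  exact mem_surface_iff.2 ⟨a, b, hab, mem_active_combo (h1 ha) (h2 ha) ht.le ht'.le htt,
    mem_active_combo (h1 hb) (h2 hb) ht.le ht'.le htt⟩

end TropPoly
-- Edges of elementary tetrahedra and level conditions
open Matrix

/-- The linear form `⟨·, w⟩` is constant on `M`. -/
def IsLevel (M : Finset (Fin 3 → ℕ)) (w : Space) : Prop :=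
  ∀ a ∈ M, ∀ b ∈ M, expPoint a ⬝ᵥ w = expPoint b ⬝ᵥ w

/-- The exponents in `S` are vertices of an elementary tetrahedron. -/
def IsElementary (S : Finset (Fin 3 → ℕ)) : Prop :=
  ∃ v : Fin 4 → Fin 3 → ℤ, IsUnimodular v ∧ ∀ a ∈ S, ∃ i, toInt a = v i

/-- Two vectors orthogonal to the same plane are proportional. -/
lemma smul_eq_smul_of_orthogonal {w d x y : Space} (hx : x ⬝ᵥ w = 0)
    (hx' : x ⬝ᵥ d = 0) (hy : y ⬝ᵥ w = 0) (hy' : y ⬝ᵥ d = 0) :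
    (y ⬝ᵥ crossProduct w d) • x = (x ⬝ᵥ crossProduct w d) • y := by
  have key : ∀ x : Space, x ⬝ᵥ w = 0 → x ⬝ᵥ d = 0 → ∀ i j, x i * crossProduct w d j =
      x j * crossProduct w d i := by
    intro x h1 h2 i j
    simp only [dotProduct, Fin.sum_univ_three] at h1 h2
    rw [cross_apply]
    fin_cases i <;> fin_cases j <;> simp <;>
      first
        | ring1
        | linear_combination w 0 * h2 - d 0 * h1
        | linear_combination d 0 * h1 - w 0 * h2
        | linear_combination w 1 * h2 - d 1 * h1
        | linear_combination d 1 * h1 - w 1 * h2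
        | linear_combination w 2 * h2 - d 2 * h1
        | linear_combination d 2 * h1 - w 2 * h2
  ext k
  simp only [Pi.smul_apply, smul_eq_mul, dotProduct, Finset.sum_mul]
  refine Finset.sum_congr rfl fun i _ => ?_
  have h1 := key x hx hx' k i
  linear_combination (y i) * h1 - (x i) * key y hy hy' k i

namespace IsElementary

variable {S : Finset (Fin 3 → ℕ)}

lemma card_le (hS : IsElementary S) : S.card ≤ 4 := by
  obtain ⟨v, -, hv⟩ := hS
  choose! ι hι using hv
  have : Set.InjOn ι S := fun a ha b hb h =>
    toInt_injective ((hι a ha).trans ((congrArg v h).trans (hι b hb).symm))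
  simpa using Finset.card_le_card_of_injOn ι (fun _ _ => Finset.mem_univ _) this

lemma eq_zero_of_isLevel (hS : IsElementary S) (hcard : S.card = 4) {w : Space}
    (hw : IsLevel S w) : w = 0 := by
  obtain ⟨v, hv, hSv⟩ := hS
  choose! ι hι using hSv
  have hinj : Set.InjOn ι S := fun a ha b hb h =>
    toInt_injective ((hι a ha).trans ((congrArg v h).trans (hι b hb).symm))
  have himg : S.image ι = Finset.univ := Finset.eq_univ_of_card _ (by
    rw [Finset.card_image_of_injOn hinj, hcard, Fintype.card_fin])
  refine hv.eq_zero_of_const fun i => ?_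
  have hmem : ∀ i, ∃ a ∈ S, intVec (v i) = expPoint a := by
    intro i
    obtain ⟨a, ha, rfl⟩ := Finset.mem_image.1 (himg ▸ Finset.mem_univ i)
    exact ⟨a, ha, by rw [← hι a ha, intVec_toInt]⟩
  obtain ⟨a, ha, hai⟩ := hmem i
  obtain ⟨b, hb, hb0⟩ := hmem 0
  rw [hai, hb0]
  exact hw a ha b hb

/-- `u` is the linear part of the barycentric coordinate belonging to `a`. -/
lemma exists_separating (hS : IsElementary S) {a : Fin 3 → ℕ} (ha : a ∈ S) :
    ∃ (u : Space) (κ : ℝ), expPoint a ⬝ᵥ u = κ + 1 ∧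
      ∀ b ∈ S, b ≠ a → expPoint b ⬝ᵥ u = κ := by
  obtain ⟨v, hv, hSv⟩ := hS
  obtain ⟨i, hi⟩ := hSv a ha
  obtain ⟨u, hu⟩ := hv.exists_affine fun j => if j = i then 1 else 0
  refine ⟨u, intVec (v 0) ⬝ᵥ u - if (0 : Fin 4) = i then 1 else 0, ?_, fun b hb hba => ?_⟩
  · have := hu i
    rw [← hi, intVec_toInt, if_pos rfl] at this
    linarith
  · obtain ⟨j, hj⟩ := hSv b hb
    have hji : j ≠ i := fun h => hba (toInt_injective (by rw [hj, hi, h]))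
    have := hu j
    rw [← hj, intVec_toInt, if_neg hji] at this
    linarith

/-- Two pairs of vertices of an elementary tetrahedron with parallel differences coincide. -/
lemma false_of_parallel (hS : IsElementary S) {w d : Space} (hwd : crossProduct w d ≠ 0)
    {a b c e : Fin 3 → ℕ} (ha : a ∈ S) (hb : b ∈ S) (hc : c ∈ S) (he : e ∈ S) (hab : a ≠ b)
    (hce : c ≠ e) (hac : a ≠ c) (hae : a ≠ e)
    (h1 : expPoint a ⬝ᵥ w = expPoint b ⬝ᵥ w) (h2 : expPoint a ⬝ᵥ d = expPoint b ⬝ᵥ d)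
    (h3 : expPoint c ⬝ᵥ w = expPoint e ⬝ᵥ w) (h4 : expPoint c ⬝ᵥ d = expPoint e ⬝ᵥ d) :
    False := by
  obtain ⟨u, κ, hua, hu⟩ := hS.exists_separating ha
  have hpar := smul_eq_smul_of_orthogonal (w := w) (d := d) (x := expPoint a - expPoint b)
    (y := expPoint c - expPoint e) (by rw [sub_dotProduct, h1, sub_self])
    (by rw [sub_dotProduct, h2, sub_self]) (by rw [sub_dotProduct, h3, sub_self])
    (by rw [sub_dotProduct, h4, sub_self])
  -- Pairing with `u` kills `c - e` and sends `a - b` to `1`, so the factor in front of `a - b` is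
  -- zero. Then `c - e` is both parallel and orthogonal to `w × d`.
  have h5 := congrArg (fun z => z ⬝ᵥ u) hpar
  simp only [smul_dotProduct, sub_dotProduct, hua, hu b hb hab.symm, hu c hc hac.symm,
    hu e he hae.symm, sub_self, smul_eq_mul, mul_zero] at h5
  have h6 : expPoint c ⬝ᵥ crossProduct w d - expPoint e ⬝ᵥ crossProduct w d = 0 := by linarith
  have h7 : expPoint c - expPoint e = 0 := by
    rw [← sub_dotProduct] at h6
    have h8 := smul_eq_smul_of_orthogonal (w := w) (d := d) (x := expPoint c - expPoint e)
      (y := crossProduct w d) (by rw [sub_dotProduct, h3, sub_self])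
      (by rw [sub_dotProduct, h4, sub_self])
      (by rw [dotProduct_comm, dot_self_cross]) (by rw [dotProduct_comm, dot_cross_self])
    rw [h6, zero_smul] at h8
    refine (smul_eq_zero.1 h8).resolve_left fun h => hwd ?_
    exact dotProduct_self_eq_zero.1 h
  exact hce (expPoint_injective (sub_eq_zero.1 h7))

lemma eq_of_isLevel (hS : IsElementary S) {w d : Space} (hwd : crossProduct w d ≠ 0)
    {M N : Finset (Fin 3 → ℕ)} (hM : M ⊆ S) (hN : N ⊆ S) (hMc : M.card = 2) (hNc : N.card = 2)
    (hMw : IsLevel M w) (hMd : IsLevel M d) (hNw : IsLevel N w) (hNd : IsLevel N d) : M = N := by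
  refine Finset.eq_of_subset_of_card_le (fun a ha => ?_) (by rw [hMc, hNc])
  by_contra haN
  obtain ⟨b, hb, hba⟩ := Finset.exists_mem_ne (by rw [hMc]; norm_num) a
  obtain ⟨c, e, hce, rfl⟩ := Finset.card_eq_two.1 hNc
  simp only [Finset.mem_insert, Finset.mem_singleton, not_or] at haN
  have hc : c ∈ ({c, e} : Finset _) := by simp
  have he : e ∈ ({c, e} : Finset _) := by simp
  exact hS.false_of_parallel hwd (hM ha) (hM hb) (hN hc) (hN he) hba.symm hce haN.1 haN.2
    (hMw a ha b hb) (hMd a ha b hb) (hNw c hc e he) (hNd c hc e he)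

/-- Three distinct edges of an elementary tetrahedron orthogonal to a common vector form a
triangle. -/
lemma exists_triangle (hS : IsElementary S) {w : Space} (hw : w ≠ 0)
    {M N P : Finset (Fin 3 → ℕ)} (hM : M ⊆ S) (hN : N ⊆ S) (hP : P ⊆ S) (hMc : M.card = 2)
    (hNc : N.card = 2) (hPc : P.card = 2) (hMN : M ≠ N) (hMP : M ≠ P) (hNP : N ≠ P)
    (hMw : IsLevel M w) (hNw : IsLevel N w) (hPw : IsLevel P w) :
    ∃ a b c, a ≠ b ∧ a ≠ c ∧ b ≠ c ∧ M = {a, c} ∧ N = {b, c} ∧ P = {a, b} := by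
  have hcard := hS.card_le
  have hfull : ∀ {a b c e}, a ∈ S → b ∈ S → c ∈ S → e ∈ S → a ≠ b → a ≠ c → a ≠ e → b ≠ c →
      b ≠ e → c ≠ e → S = {a, b, c, e} := by
    intro a b c e ha hb hc he h1 h2 h3 h4 h5 h6
    have h4 : ({a, b, c, e} : Finset (Fin 3 → ℕ)).card = 4 := by
      rw [Finset.card_insert_of_notMem (by simp [*]), Finset.card_insert_of_notMem (by simp [*]),
        Finset.card_pair h6]
    refine (Finset.eq_of_subset_of_card_le ?_ (by rw [h4]; exact hcard)).symm
    intro x hx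
    simp only [Finset.mem_insert, Finset.mem_singleton] at hx
    rcases hx with rfl | rfl | rfl | rfl <;> assumption
  -- Four vertices cannot all have the same level, because `w ≠ 0`. Hence edges orthogonal to `w`
  -- cannot connect all four vertices.
  have hlev : ∀ {a b c e}, a ∈ S → b ∈ S → c ∈ S → e ∈ S → a ≠ b → a ≠ c → a ≠ e → b ≠ c →
      b ≠ e → c ≠ e → expPoint a ⬝ᵥ w = expPoint b ⬝ᵥ w → expPoint a ⬝ᵥ w = expPoint c ⬝ᵥ w →
      expPoint a ⬝ᵥ w = expPoint e ⬝ᵥ w → False := by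
    intro a b c e ha hb hc he h1 h2 h3 h4 h5 h6 g1 g2 g3
    have hSe := hfull ha hb hc he h1 h2 h3 h4 h5 h6
    refine hw (hS.eq_zero_of_isLevel ?_ ?_)
    · rw [hSe, Finset.card_insert_of_notMem (by simp [*]),
        Finset.card_insert_of_notMem (by simp [*]), Finset.card_pair h6]
    · have : ∀ x ∈ S, expPoint x ⬝ᵥ w = expPoint a ⬝ᵥ w := by
        intro x hx
        rw [hSe] at hx
        simp only [Finset.mem_insert, Finset.mem_singleton] at hx
        rcases hx with h | h | h | h <;> rw [h]
        exacts [g1.symm, g2.symm, g3.symm]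
      exact fun x hx y hy => (this x hx).trans (this y hy).symm
  obtain ⟨a, b, hab, rfl⟩ := Finset.card_eq_two.1 hMc
  obtain ⟨c, e, hce, rfl⟩ := Finset.card_eq_two.1 hNc
  obtain ⟨x, y, hxy, rfl⟩ := Finset.card_eq_two.1 hPc
  have ga : expPoint a ⬝ᵥ w = expPoint b ⬝ᵥ w := hMw a (by simp) b (by simp)
  have gc : expPoint c ⬝ᵥ w = expPoint e ⬝ᵥ w := hNw c (by simp) e (by simp)
  have gx : expPoint x ⬝ᵥ w = expPoint y ⬝ᵥ w := hPw x (by simp) y (by simp)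
  simp only [Finset.insert_subset_iff, Finset.singleton_subset_iff] at hM hN hP
  have hpair : ∀ a b, ({a, b} : Finset (Fin 3 → ℕ)) ≠ {x, y} →
      (x = a → y = b → False) ∧ (x = b → y = a → False) := by
    refine fun a b h => ⟨fun h1 h2 => h (by rw [h1, h2]), fun h1 h2 => h ?_⟩
    rw [h1, h2, Finset.pair_comm]
  -- The edges `{a, c}` and `{b, c}` put `a, b, c` on one level. The third edge cannot join them to
  -- a fourth vertex, nor avoid all three, so it is the remaining side.
  have core : ∀ a b c, a ∈ S → b ∈ S → c ∈ S → a ≠ b → a ≠ c → b ≠ c →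
      expPoint a ⬝ᵥ w = expPoint c ⬝ᵥ w → expPoint b ⬝ᵥ w = expPoint c ⬝ᵥ w →
      ({a, c} : Finset _) ≠ {x, y} → ({b, c} : Finset _) ≠ {x, y} →
      ({x, y} : Finset (Fin 3 → ℕ)) = {a, b} := by
    intro a b c ha hb hc hab hac hbc hga hgb n1 n2
    have step : ∀ x y : Fin 3 → ℕ, x ∈ S → y ∈ S → x ≠ y →
        expPoint x ⬝ᵥ w = expPoint y ⬝ᵥ w → ({a, c} : Finset _) ≠ {x, y} →
        ({b, c} : Finset _) ≠ {x, y} → x = a ∨ x = b ∨ x = c → y = a ∨ y = b ∨ y = c := by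
      intro x y hx hy hxy hg _ _ hx3
      by_contra! hy3
      refine hlev ha hb hc hy hab hac hy3.1.symm hbc hy3.2.1.symm hy3.2.2.symm
        (hga.trans hgb.symm) hga ?_
      rcases hx3 with h | h | h <;> subst h
      exacts [hg, (hga.trans hgb.symm).trans hg, hga.trans hg]
    by_cases hx3 : x = a ∨ x = b ∨ x = c
    · have hy3 := step x y hP.1 hP.2 hxy gx n1 n2 hx3
      obtain ⟨m1, m2⟩ := hpair _ _ n1
      obtain ⟨m3, m4⟩ := hpair _ _ n2
      have : (x = a ∧ y = b) ∨ (x = b ∧ y = a) := by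
        rcases hx3 with h | h | h <;> rcases hy3 with h' | h' | h' <;>
          first
            | exact (hxy (h.trans h'.symm)).elim
            | exact (m1 h h').elim
            | exact (m2 h h').elim
            | exact (m3 h h').elim
            | exact (m4 h h').elim
            | exact Or.inl ⟨h, h'⟩
            | exact Or.inr ⟨h, h'⟩
      rcases this with ⟨h, h'⟩ | ⟨h, h'⟩
      · rw [h, h']
      · rw [h, h', Finset.pair_comm]
    · by_cases hy3 : y = a ∨ y = b ∨ y = c
      · rw [Finset.pair_comm x y] at n1 n2
        exact absurd (step y x hP.2 hP.1 hxy.symm gx.symm n1 n2 hy3) hx3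
      · push Not at hx3 hy3
        have h4 := hfull ha hb hc hP.1 hab hac hx3.1.symm hbc hx3.2.1.symm hx3.2.2.symm
        have h5 := hP.2
        rw [h4] at h5
        simp only [Finset.mem_insert, Finset.mem_singleton, hy3, hxy.symm, or_self] at h5
  by_cases hac : a = c
  · subst hac
    have hbe : b ≠ e := fun h => hMN (by rw [h])
    exact ⟨b, e, a, hbe, hab.symm, hce.symm, Finset.pair_comm _ _, Finset.pair_comm _ _,
      core b e a hM.2 hN.2 hM.1 hbe hab.symm hce.symm ga.symm gc.symm
        (by rwa [Finset.pair_comm]) (by rwa [Finset.pair_comm])⟩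
  by_cases hae : a = e
  · subst hae
    have hbe : b ≠ c := fun h => hMN (by rw [h, Finset.pair_comm])
    exact ⟨b, c, a, hbe, hab.symm, hce, Finset.pair_comm _ _, rfl,
      core b c a hM.2 hN.1 hM.1 hbe hab.symm hce ga.symm gc
        (by rwa [Finset.pair_comm]) hNP⟩
  by_cases hbc : b = c
  · subst hbc
    exact ⟨a, e, b, hae, hab, hce.symm, rfl, Finset.pair_comm _ _,
      core a e b hM.1 hN.2 hM.2 hae hab hce.symm ga gc.symm hMP
        (by rwa [Finset.pair_comm])⟩
  by_cases hbe : b = e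
  · subst hbe
    exact ⟨a, c, b, hac, hab, hce, rfl, rfl, core a c b hM.1 hN.1 hM.2 hac hab hce ga gc hMP hNP⟩
  exfalso
  -- If the first two edges are disjoint, they cover all vertices, and any third edge joins them,
  -- which puts all four vertices on one level.
  have hSe := hfull hM.1 hM.2 hN.1 hN.2 hab hac hae hbc hbe hce
  suffices hgac : expPoint a ⬝ᵥ w = expPoint c ⬝ᵥ w from
    hlev hM.1 hM.2 hN.1 hN.2 hab hac hae hbc hbe hce ga hgac (hgac.trans gc)
  obtain ⟨m1, m2⟩ := hpair _ _ hMP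
  obtain ⟨m3, m4⟩ := hpair _ _ hNP
  have hx := hP.1
  have hy := hP.2
  rw [hSe] at hx hy
  simp only [Finset.mem_insert, Finset.mem_singleton] at hx hy
  rcases hx with h | h | h | h <;> rcases hy with h' | h' | h' | h' <;>
    first
      | exact (hxy (h.trans h'.symm)).elim
      | exact (m1 h h').elim
      | exact (m2 h h').elim
      | exact (m3 h h').elim
      | exact (m4 h h').elim
      | (rw [h, h'] at gx; first
          | exact gx | exact gx.symm | exact ga.trans gx | exact ga.trans gx.symm
          | exact gx.trans gc.symm | exact gx.symm.trans gc.symm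
          | exact (ga.trans gx).trans gc.symm | exact (ga.trans gx.symm).trans gc.symm)

lemma eq_symmDiff (hS : IsElementary S) {w : Space} (hw : w ≠ 0)
    {M N P : Finset (Fin 3 → ℕ)} (hM : M ⊆ S) (hN : N ⊆ S) (hP : P ⊆ S) (hMc : M.card = 2)
    (hNc : N.card = 2) (hPc : P.card = 2) (hMN : M ≠ N) (hMP : M ≠ P) (hNP : N ≠ P)
    (hMw : IsLevel M w) (hNw : IsLevel N w) (hPw : IsLevel P w) : P = symmDiff M N := by
  obtain ⟨a, b, c, hab, hac, hbc, rfl, rfl, rfl⟩ :=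
    hS.exists_triangle hw hM hN hP hMc hNc hPc hMN hMP hNP hMw hNw hPw
  ext x
  simp only [Finset.mem_symmDiff, Finset.mem_insert, Finset.mem_singleton]
  grind

/-- The map `(p, q)` sends the lattice onto `ℤ²`, and modulo `n` it kills the edges of the triangle.
The edges of the tetrahedron generate the lattice, so `(ℤ/n)²` is generated by the image of the one
edge leading to the fourth vertex `v l`. This is possible only if `n` is a unit. -/
lemma dvd_one_of_triangle (hS : IsElementary S) {a b c : Fin 3 → ℕ} (ha : a ∈ S) (hb : b ∈ S)
    (hc : c ∈ S) (hab : a ≠ b) (hac : a ≠ c) (hbc : b ≠ c) {p q : Fin 3 → ℤ}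
    (hpq : ∃ z, p ⬝ᵥ z = 1 ∧ q ⬝ᵥ z = 0) (hqp : ∃ z, p ⬝ᵥ z = 0 ∧ q ⬝ᵥ z = 1) {n : ℤ}
    (hpa : n ∣ p ⬝ᵥ toInt a - p ⬝ᵥ toInt c) (hpb : n ∣ p ⬝ᵥ toInt b - p ⬝ᵥ toInt c)
    (hqa : n ∣ q ⬝ᵥ toInt a - q ⬝ᵥ toInt c) (hqb : n ∣ q ⬝ᵥ toInt b - q ⬝ᵥ toInt c) : n ∣ 1 := by
  obtain ⟨v, hv, hSv⟩ := hS
  obtain ⟨i, hi⟩ := hSv a ha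
  obtain ⟨j, hj⟩ := hSv b hb
  obtain ⟨k, hk⟩ := hSv c hc
  have hij : i ≠ j := fun h => hab (toInt_injective (by rw [hi, hj, h]))
  have hik : i ≠ k := fun h => hac (toInt_injective (by rw [hi, hk, h]))
  have hjk : j ≠ k := fun h => hbc (toInt_injective (by rw [hj, hk, h]))
  obtain ⟨l, hl⟩ : ∃ l, ∀ m : Fin 4, m ≠ l → m = i ∨ m = j ∨ m = k := by
    clear hi hj hk
    revert i j k; decide
  have hspan : ∀ z : Fin 3 → ℤ, ∃ e : Fin 4 → ℤ, ∀ r : Fin 3 → ℤ,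
      r ⬝ᵥ z = ∑ m, e m * (r ⬝ᵥ v m - r ⬝ᵥ v k) := by
    intro z
    obtain ⟨e, he⟩ := hv.exists_int_combination z
    refine ⟨Fin.cons (-∑ m, e m) e, fun r => ?_⟩
    rw [Fin.sum_univ_succ]
    simp only [Fin.cons_zero, Fin.cons_succ, Fin.sum_univ_three, dotProduct, he]
    ring
  have hmod : ∀ z : Fin 3 → ℤ, ∃ e : ℤ, n ∣ p ⬝ᵥ z - e * (p ⬝ᵥ v l - p ⬝ᵥ v k) ∧
      n ∣ q ⬝ᵥ z - e * (q ⬝ᵥ v l - q ⬝ᵥ v k) := by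
    intro z
    obtain ⟨e, he⟩ := hspan z
    have aux : ∀ r : Fin 3 → ℤ, n ∣ r ⬝ᵥ toInt a - r ⬝ᵥ toInt c →
        n ∣ r ⬝ᵥ toInt b - r ⬝ᵥ toInt c → n ∣ r ⬝ᵥ z - e l * (r ⬝ᵥ v l - r ⬝ᵥ v k) := by
      intro r h1 h2
      rw [he r, ← Finset.add_sum_erase _ _ (Finset.mem_univ l), add_sub_cancel_left]
      refine Finset.dvd_sum fun m hm => Dvd.dvd.mul_left ?_ _
      rw [hi, hk] at h1
      rw [hj, hk] at h2
      rcases hl m (Finset.ne_of_mem_erase hm) with rfl | rfl | rfl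
      · exact h1
      · exact h2
      · simp
    exact ⟨e l, aux p hpa hpb, aux q hqa hqb⟩
  obtain ⟨z, hz1, hz2⟩ := hpq
  obtain ⟨z', hz1', hz2'⟩ := hqp
  obtain ⟨e, ⟨x1, h1⟩, ⟨x2, h2⟩⟩ := hmod z
  obtain ⟨e', ⟨x3, h3⟩, ⟨x4, h4⟩⟩ := hmod z'
  rw [hz1] at h1
  rw [hz2] at h2
  rw [hz1'] at h3
  rw [hz2'] at h4
  generalize p ⬝ᵥ v l - p ⬝ᵥ v k = y at *
  generalize q ⬝ᵥ v l - q ⬝ᵥ v k = y' at *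
  -- Modulo `n`, `e (y, y') = (1, 0)` and `e' (y, y') = (0, 1)`, so `1 = (e y)(e' y') = (e y')(e' y)
  -- = 0`.
  refine ⟨x1 + e * y * x4 + x2 * (- e' * y), ?_⟩
  linear_combination h1 + e * y * h4 - e' * y * h2

end IsElementary

/-! ### Planar pieces of a smooth surface -/

namespace TropPoly

variable {f : TropPoly}

lemma IsSmooth.isElementary (hf : f.IsSmooth) (x : Space) : IsElementary (f.active x) :=
  hf.exists_isUnimodular x

/-- A piece of a plane contained in a smooth surface is contained in a single cell. -/
lemma IsSmooth.exists_pair_of_plane (hf : f.IsSmooth) {p w d : Space}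
    (hwd : crossProduct w d ≠ 0) {R : Set (ℝ × ℝ)} (hRo : IsOpen R) (hRc : Convex ℝ R)
    (hRn : R.Nonempty) (hR : ∀ z ∈ R, p + z.1 • w + z.2 • d ∈ f.surface) :
    ∃ M : Finset (Fin 3 → ℕ), M.card = 2 ∧ IsLevel M w ∧ IsLevel M d ∧
      ∀ z ∈ closure R, M ⊆ f.active (p + z.1 • w + z.2 • d) := by
  set φ : ℝ × ℝ → Space := fun z => p + z.1 • w + z.2 • d with hφ
  have hφc : Continuous φ := by fun_prop
  have hval : ∀ a z, f.mono a (φ z) =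
      f.mono a p + z.1 * (expPoint a ⬝ᵥ w) + z.2 * (expPoint a ⬝ᵥ d) := by
    intro a z
    rw [hφ, mono_add_smul, mono_add_smul]
  -- Near a point with locally constant active set, the active monomials agree on an open part of
  -- the plane, so they have equal slopes along `w` and `d`. Such a point can be chosen so that its
  -- active set is contained in that at `z`.
  have hgen : ∀ z ∈ R, ∃ a b, a ≠ b ∧ a ∈ f.active (φ z) ∧ b ∈ f.active (φ z) ∧
      expPoint a ⬝ᵥ w = expPoint b ⬝ᵥ w ∧ expPoint a ⬝ᵥ d = expPoint b ⬝ᵥ d := by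
    intro z hz
    obtain ⟨q, hq, hqz, hev⟩ := exists_eventually_active_eq (f := f) hφc hz
    rw [hRo.nhdsWithin_eq hq] at hev
    obtain ⟨a, b, hab, ha, hb⟩ := mem_surface_iff.1 (hR q hq)
    have hdir : ∀ u : ℝ × ℝ, ∃ ε : ℝ, 0 < ε ∧ f.active (φ (q + ε • u)) = f.active (φ q) := by
      intro u
      have hc : Continuous fun ε : ℝ => q + ε • u := by fun_prop
      have ht := hc.tendsto 0
      rw [zero_smul, add_zero] at ht
      obtain ⟨ε, h1, h2⟩ := (((ht.mono_left nhdsWithin_le_nhds).eventually hev).and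
        (self_mem_nhdsWithin : Set.Ioi (0 : ℝ) ∈ 𝓝[>] 0)).exists
      exact ⟨ε, h2, h1⟩
    have h0 := mono_eq_of_mem_active ha hb
    refine ⟨a, b, hab, hqz ha, hqz hb, ?_, ?_⟩
    · obtain ⟨ε, hε, he⟩ := hdir (1, 0)
      have h1 := mono_eq_of_mem_active (he ▸ ha) (he ▸ hb)
      change f.mono a (φ q) = f.mono b (φ q) at h0
      rw [hval, hval] at h0 h1
      simp only [Prod.fst_add, Prod.snd_add, Prod.smul_fst, Prod.smul_snd, smul_eq_mul, mul_one,
        mul_zero, add_zero] at h1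
      exact mul_left_cancel₀ hε.ne' (by linarith)
    · obtain ⟨ε, hε, he⟩ := hdir (0, 1)
      have h1 := mono_eq_of_mem_active (he ▸ ha) (he ▸ hb)
      change f.mono a (φ q) = f.mono b (φ q) at h0
      rw [hval, hval] at h0 h1
      simp only [Prod.fst_add, Prod.snd_add, Prod.smul_fst, Prod.smul_snd, smul_eq_mul, mul_one,
        mul_zero, add_zero] at h1
      exact mul_left_cancel₀ hε.ne' (by linarith)
  obtain ⟨z₀, hz₀⟩ := hRn
  obtain ⟨a, b, hab, ha, hb, haw, had⟩ := hgen z₀ hz₀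
  have hmono : ∀ z, f.mono a (φ z) = f.mono b (φ z) := by
    intro z
    have h0 := mono_eq_of_mem_active ha hb
    rw [hval, hval] at h0 ⊢
    rw [haw, had] at *
    linarith
  have hb' : ∀ z, a ∈ f.active (φ z) → b ∈ f.active (φ z) := fun z h =>
    mem_active_of_mono_eq h (active_subset_support _ hb) (hmono z).symm
  -- Otherwise the connected region `R` has a point where `a, b` and another pair `c, e` avoiding
  -- `a` are all active. Both differences are orthogonal to the plane, hence parallel, which an
  -- elementary tetrahedron forbids.
  have hall : ∀ z ∈ R, a ∈ f.active (φ z) := by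
    by_contra! hcon
    obtain ⟨z₁, hz₁, hz₁a⟩ := hcon
    set Q : Set ((Fin 3 → ℕ) × (Fin 3 → ℕ)) := {e | e.1 ∈ f.support ∧ e.2 ∈ f.support ∧
      e.1 ≠ e.2 ∧ a ≠ e.1 ∧ a ≠ e.2 ∧ expPoint e.1 ⬝ᵥ w = expPoint e.2 ⬝ᵥ w ∧
      expPoint e.1 ⬝ᵥ d = expPoint e.2 ⬝ᵥ d} with hQ
    have hQfin : Q.Finite := ((Finset.finite_toSet f.support).prod
      (Finset.finite_toSet f.support)).subset fun e he => ⟨he.1, he.2.1⟩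
    have hcl1 : IsClosed {z | a ∈ f.active (φ z)} := (isClosed_mem_active a).preimage hφc
    have hcl2 : IsClosed (⋃ e ∈ Q, {z | e.1 ∈ f.active (φ z) ∧ e.2 ∈ f.active (φ z)}) :=
      hQfin.isClosed_biUnion fun e _ => ((isClosed_mem_active e.1).preimage hφc).inter
        ((isClosed_mem_active e.2).preimage hφc)
    have hcov : ∀ z ∈ R, a ∉ f.active (φ z) →
        z ∈ ⋃ e ∈ Q, {z | e.1 ∈ f.active (φ z) ∧ e.2 ∈ f.active (φ z)} := by
      intro z hz haz
      obtain ⟨c, e, hce, hc, he, h1, h2⟩ := hgen z hz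
      exact Set.mem_biUnion (x := (c, e)) ⟨active_subset_support _ hc, active_subset_support _ he,
        hce, fun h => haz (h ▸ hc), fun h => haz (h ▸ he), h1, h2⟩ ⟨hc, he⟩
    obtain ⟨z, _, hza, hzQ⟩ := isPreconnected_closed_iff.1 hRc.isPreconnected _ _ hcl1 hcl2
      (fun z hz => or_iff_not_imp_left.2 (hcov z hz)) ⟨z₀, hz₀, ha⟩ ⟨z₁, hz₁, hcov z₁ hz₁ hz₁a⟩
    simp only [Set.mem_iUnion] at hzQ
    obtain ⟨⟨c, e⟩, ⟨-, -, hce, hac, hae, h1, h2⟩, hc, he⟩ := hzQ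
    exact (hf.isElementary (φ z)).false_of_parallel hwd hza (hb' z hza) hc he hab hce hac hae
      haw had h1 h2
  have hcl : ∀ z ∈ closure R, a ∈ f.active (φ z) :=
    closure_minimal hall ((isClosed_mem_active a).preimage hφc)
  refine ⟨{a, b}, Finset.card_pair hab, ?_, ?_, fun z hz => ?_⟩
  · intro x hx y hy
    simp only [Finset.mem_insert, Finset.mem_singleton] at hx hy
    rcases hx with rfl | rfl <;> rcases hy with rfl | rfl <;> simp [haw]
  · intro x hx y hy
    simp only [Finset.mem_insert, Finset.mem_singleton] at hx hy
    rcases hx with rfl | rfl <;> rcases hy with rfl | rfl <;> simp [had]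
  · simp only [Finset.insert_subset_iff, Finset.singleton_subset_iff]
    exact ⟨hcl z hz, hb' z (hcl z hz)⟩

end TropPoly

/-! ### Degree -/

/-- The barycentric coordinates (multiplied by `δ`) with respect to the simplex `Γ_δ`. -/
def bary (δ : ℕ) (i : Fin 4) (a : Fin 3 → ℕ) : ℤ :=
  (if i = 3 then (δ : ℤ) else 0) - rayDir i ⬝ᵥ toInt a

lemma sum_bary (δ : ℕ) (a : Fin 3 → ℕ) : ∑ i, bary δ i a = δ := by
  simp [Fin.sum_univ_four, bary, rayDir, dotProduct, Fin.sum_univ_three]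
  ring

lemma cast_bary (δ : ℕ) (i : Fin 4) (a : Fin 3 → ℕ) :
    (bary δ i a : ℝ) = (if i = 3 then (δ : ℝ) else 0) - expPoint a ⬝ᵥ intVec (rayDir i) := by
  rw [← intVec_toInt, dotProduct_comm]
  simp only [bary, dotProduct, intVec]
  push_cast
  rfl

namespace TropPoly

variable {f : TropPoly} {δ : ℕ}

lemma isLinearMap_dotProduct (w : Space) : IsLinearMap ℝ fun z : Space => z ⬝ᵥ w :=
  ⟨fun _ _ => add_dotProduct _ _ _, fun _ _ => smul_dotProduct _ _ _⟩

lemma HasDegree.bary_nonneg (hf : f.HasDegree δ) (i : Fin 4) {a : Fin 3 → ℕ}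
    (ha : a ∈ f.support) : 0 ≤ bary δ i a := by
  have hsub : simplexGamma δ ⊆
      {z | z ⬝ᵥ intVec (rayDir i) ≤ if i = 3 then (δ : ℝ) else 0} := by
    refine convexHull_min ?_ (convex_halfSpace_le (isLinearMap_dotProduct _) _)
    have hδ : (0 : ℝ) ≤ δ := Nat.cast_nonneg δ
    rintro z (rfl | ⟨j, rfl⟩)
    · simp only [Set.mem_ofPred_eq, zero_dotProduct]; split_ifs <;> simp
    · simp only [Set.mem_ofPred_eq, single_dotProduct]
      fin_cases i <;> fin_cases j <;> simp [rayDir, intVec]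
  have h1 : expPoint a ∈ simplexGamma δ := by
    rw [← hf]; exact subset_convexHull ℝ _ ⟨a, ha, rfl⟩
  have h2 := hsub h1
  simp only [Set.mem_ofPred_eq] at h2
  have h3 := cast_bary δ i a
  have : (0 : ℝ) ≤ bary δ i a := by rw [h3]; linarith
  exact_mod_cast this

/-- The coordinates are integers, so without an exponent on the facet the Newton polytope would keep
distance at least one from it. The vertex `0` contradicts this for `i ≠ 3`, and the vertex `δ e₁`
for `i = 3`. -/
lemma HasDegree.exists_bary_eq_zero (hf : f.HasDegree δ) (i : Fin 4) :
    ∃ a ∈ f.support, bary δ i a = 0 := by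
  by_contra! hcon
  have hsub : f.newtonPolytope ⊆
      {z | z ⬝ᵥ intVec (rayDir i) ≤ (if i = 3 then (δ : ℝ) else 0) - 1} := by
    refine convexHull_min ?_ (convex_halfSpace_le (isLinearMap_dotProduct _) _)
    rintro _ ⟨a, ha, rfl⟩
    have h1 : 1 ≤ bary δ i a := by
      have := hf.bary_nonneg i ha
      have := hcon a ha
      omega
    have h2 : (1 : ℝ) ≤ bary δ i a := by exact_mod_cast h1
    rw [cast_bary] at h2
    simp only [Set.mem_ofPred_eq]
    linarith
  rw [hf] at hsub
  have h0 : (0 : Space) ∈ simplexGamma δ := subset_convexHull ℝ _ (Set.mem_insert _ _)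
  have h1 : (Pi.single 0 (δ : ℝ) : Space) ∈ simplexGamma δ :=
    subset_convexHull ℝ _ (Set.mem_insert_of_mem _ ⟨0, rfl⟩)
  have h0' := hsub h0
  have h1' := hsub h1
  simp only [Set.mem_ofPred_eq, zero_dotProduct, single_dotProduct] at h0' h1'
  split_ifs at h0' h1' with h
  · subst h
    rw [show intVec (rayDir 3) 0 = 1 by simp [intVec, rayDir]] at h1'
    linarith
  · norm_num at h0'

/-- Exponents active along a whole ray lie in the corresponding face of the simplex. -/
lemma HasDegree.bary_eq_zero (hf : f.HasDegree δ) {i : Fin 4} {a : Fin 3 → ℕ} {p : Space}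
    (h : ∀ s : ℝ, 0 ≤ s → a ∈ f.active (p + s • intVec (rayDir i))) : bary δ i a = 0 := by
  obtain ⟨b, hb, hb0⟩ := hf.exists_bary_eq_zero i
  have ha := hf.bary_nonneg i (active_subset_support _ (h 0 le_rfl))
  by_contra hne
  have h1 : (1 : ℝ) ≤ bary δ i a := by
    have : 1 ≤ bary δ i a := by omega
    exact_mod_cast this
  have hb0' : (bary δ i b : ℝ) = 0 := by rw [hb0]; simp
  rw [cast_bary] at h1 hb0'
  -- The slope of `b` along the ray exceeds that of `a` by `bary δ i a ≥ 1`, so at this parameter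
  -- the monomial of `b` has overtaken that of `a`.
  set s := max 0 (f.mono a p - f.mono b p + 1) with hs
  have hs1 : f.mono a p - f.mono b p + 1 ≤ s := le_max_right _ _
  have hs0 : 0 ≤ s := le_max_left _ _
  have h2 := mono_le_of_mem_active (h s hs0) hb
  rw [mono_add_smul, mono_add_smul] at h2
  nlinarith

end TropPoly

/-- Any two of the four directions are part of a lattice basis. `T` tabulates dual vectors; its
diagonal entries are fillers. -/
lemma exists_rayDir_dotProduct {i j : Fin 4} (hij : i ≠ j) :
    ∃ z, rayDir i ⬝ᵥ z = 1 ∧ rayDir j ⬝ᵥ z = 0 := by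
  let T : Fin 4 → Fin 4 → Fin 3 → ℤ :=
    ![![0, ![-1, 0, 0], ![-1, 0, 0], ![-1, 1, 0]],
      ![![0, -1, 0], 0, ![0, -1, 0], ![1, -1, 0]],
      ![![0, 0, -1], ![0, 0, -1], 0, ![1, 0, -1]],
      ![![0, 1, 0], ![1, 0, 0], ![1, 0, 0], 0]]
  refine ⟨T i j, ?_⟩
  revert i j
  decide

/-- The triangle dual to an edge of the surface along which two rays are swept out. -/
lemma IsElementary.bary_dvd_one {S : Finset (Fin 3 → ℕ)} (hS : IsElementary S) {δ : ℕ}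
    {i j : Fin 4} (hij : i ≠ j) {a b c : Fin 3 → ℕ} (ha : a ∈ S) (hb : b ∈ S) (hc : c ∈ S)
    (hab : a ≠ b) (hac : a ≠ c) (hbc : b ≠ c) (hia : bary δ i a = 0) (hic : bary δ i c = 0)
    (hjb : bary δ j b = 0) (hjc : bary δ j c = 0) (h : bary δ j a = bary δ i b) :
    bary δ j a ∣ 1 := by
  refine hS.dvd_one_of_triangle ha hb hc hab hac hbc (exists_rayDir_dotProduct hij)
    ((exists_rayDir_dotProduct hij.symm).imp fun z hz => hz.symm) ?_ ?_ ?_ ?_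
  · have : rayDir i ⬝ᵥ toInt a - rayDir i ⬝ᵥ toInt c = 0 := by
      simp only [bary] at hia hic; linarith
    simp [this]
  · have : rayDir i ⬝ᵥ toInt b - rayDir i ⬝ᵥ toInt c = - bary δ i b := by
      simp only [bary] at hia hic ⊢; linarith
    rw [this, h]; simp
  · have : rayDir j ⬝ᵥ toInt a - rayDir j ⬝ᵥ toInt c = - bary δ j a := by
      simp only [bary] at hjc hjb ⊢; linarith
    rw [this]; simp
  · have : rayDir j ⬝ᵥ toInt b - rayDir j ⬝ᵥ toInt c = 0 := by
      simp only [bary] at hjb hjc; linarith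
    simp [this]

/-! ### Tropical lines -/

lemma intVec_dotProduct (p z : Fin 3 → ℤ) : intVec p ⬝ᵥ intVec z = ((p ⬝ᵥ z : ℤ) : ℝ) := by
  simp only [dotProduct, intVec]
  push_cast
  rfl

lemma exists_intVec_rayDir_dotProduct {i j : Fin 4} (hij : i ≠ j) :
    ∃ z : Space, intVec (rayDir i) ⬝ᵥ z = 1 ∧ intVec (rayDir j) ⬝ᵥ z = 0 := by
  obtain ⟨z, h1, h2⟩ := exists_rayDir_dotProduct hij
  exact ⟨intVec z, by rw [intVec_dotProduct, h1]; simp, by rw [intVec_dotProduct, h2]; simp⟩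

lemma intVec_rayDir_ne_zero (i : Fin 4) : intVec (rayDir i) ≠ 0 := by
  obtain ⟨j, hj⟩ := exists_ne i
  obtain ⟨z, h1, -⟩ := exists_intVec_rayDir_dotProduct hj.symm
  intro h
  rw [h, zero_dotProduct] at h1
  exact zero_ne_one h1

lemma eq_zero_of_smul_rayDir {i j : Fin 4} (hij : i ≠ j) {x : Space} {r s : ℝ}
    (h1 : x = r • intVec (rayDir i)) (h2 : x = s • intVec (rayDir j)) : x = 0 := by
  obtain ⟨z, hz1, hz2⟩ := exists_intVec_rayDir_dotProduct hij
  have h3 : x ⬝ᵥ z = r := by rw [h1, smul_dotProduct, hz1, smul_eq_mul, mul_one]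
  have h4 : x ⬝ᵥ z = 0 := by rw [h2, smul_dotProduct, hz2, smul_zero]
  rw [h1, ← h3, h4, zero_smul]

lemma exists_smul_of_crossProduct_eq_zero {w d : Space} (hd : d ≠ 0)
    (h : crossProduct w d = 0) : ∃ r : ℝ, w = r • d := by
  by_contra! hcon
  have h1 : LinearIndependent ℝ ![d, w] :=
    (LinearIndependent.pair_iff' hd).2 fun r hr => hcon r hr.symm
  rw [← crossProduct_ne_zero_iff_linearIndependent, ← cross_anticomm, h, neg_zero] at h1
  exact h1 rfl

/-- The direction of the bounded edge. -/
def edgeDir (near : Finset (Fin 4)) : Fin 3 → ℤ := -∑ i ∈ near, rayDir i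

lemma edgeDir_primitive {near : Finset (Fin 4)} (h : near.card = 2) (d : ℤ)
    (hd : ∀ k, d ∣ edgeDir near k) : IsUnit d := by
  have key : ∀ s : Finset (Fin 4), s.card = 2 → ∃ k, edgeDir s k = 1 ∨ edgeDir s k = -1 := by
    decide
  obtain ⟨k, hk⟩ := key near h
  rw [Int.isUnit_iff]
  have h1 : d ∣ 1 := by
    rcases hk with hk | hk
    · exact hk ▸ hd k
    · have := hd k
      rw [hk] at this
      exact (dvd_neg.1 this)
  exact Int.isUnit_iff.1 (isUnit_of_dvd_one h1)

lemma edgeDir_compl (near : Finset (Fin 4)) : edgeDir nearᶜ = -edgeDir near := by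
  have h : ∑ i, rayDir i = 0 := by decide
  rw [← Finset.sum_add_sum_compl near] at h
  rw [edgeDir, edgeDir, neg_neg]
  exact neg_eq_of_add_eq_zero_left h

lemma edgeDir_pair {i j : Fin 4} (hij : i ≠ j) :
    intVec (edgeDir {i, j}) = -(intVec (rayDir i) + intVec (rayDir j)) := by
  ext k
  simp [edgeDir, Finset.sum_pair hij, intVec]

lemma intVec_neg (u : Fin 3 → ℤ) : intVec (-u) = -intVec u := by
  ext k; simp [intVec]

namespace TropLine

/-- The tropical line with given position of the rays, first vertex and length of the bounded
edge. -/
noncomputable def ofNear (near : Finset (Fin 4)) (h : near.card = 2) (v : Space) (len : ℝ)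
    (hlen : 0 ≤ len) : TropLine where
  v₁ := v
  v₂ := v + len • intVec (edgeDir near)
  near := near
  card_near := h
  dir := edgeDir near
  dir_primitive := edgeDir_primitive h
  len := len
  len_nonneg := hlen
  v₂_eq := rfl
  balanced₁ := by simp [edgeDir]
  balanced₂ := by rw [← edgeDir_compl]; simp [edgeDir]

lemma dir_eq (L : TropLine) : L.dir = edgeDir L.near := by
  have := L.balanced₁
  rw [edgeDir, eq_neg_iff_add_eq_zero, add_comm]
  exact this

lemma eq_ofNear (L : TropLine) : L = ofNear L.near L.card_near L.v₁ L.len L.len_nonneg := by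
  have h := L.dir_eq
  obtain ⟨v₁, v₂, near, hn, dir, hp, len, hlen, hv, h1, h2⟩ := L
  simp only at h
  subst h hv
  rfl

lemma dir_ne_zero (L : TropLine) : intVec L.dir ≠ 0 := by
  intro h
  have h2 := L.dir_primitive 2 fun k => by
    have := congrFun h k
    simp only [intVec, Pi.zero_apply, Int.cast_eq_zero] at this
    simp [this]
  rw [Int.isUnit_iff] at h2
  omega

lemma v₁_eq_v₂_iff (L : TropLine) : L.v₁ = L.v₂ ↔ L.len = 0 := by
  rw [L.v₂_eq]
  simp [L.dir_ne_zero]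

/-- The starting point of a ray. -/
noncomputable def base (L : TropLine) (i : Fin 4) : Space := if i ∈ L.near then L.v₁ else L.v₂

lemma ray_eq_image (L : TropLine) (i : Fin 4) :
    L.ray i = (fun s : ℝ => L.base i + s • intVec (rayDir i)) '' Set.Ici 0 := by
  ext p
  simp only [ray, base, Set.mem_ofPred_eq, Set.mem_image, Set.mem_Ici, eq_comm (a := p)]

lemma seg_eq_image (L : TropLine) :
    L.seg = (fun s : ℝ => L.v₁ + s • intVec L.dir) '' Set.Icc 0 L.len := by
  rw [seg, segment_eq_image']
  ext p
  constructor
  · rintro ⟨θ, hθ, rfl⟩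
    refine ⟨θ * L.len, ⟨mul_nonneg hθ.1 L.len_nonneg, ?_⟩, ?_⟩
    · nlinarith [L.len_nonneg, hθ.2]
    · simp only [L.v₂_eq, add_sub_cancel_left, smul_smul]
  · rintro ⟨s, hs, rfl⟩
    rcases L.len_nonneg.eq_or_lt with h0 | h0
    · have : s = 0 := le_antisymm (h0 ▸ hs.2) hs.1
      exact ⟨0, by simp, by simp [this]⟩
    · refine ⟨s / L.len, ⟨div_nonneg hs.1 h0.le, (div_le_one h0).2 hs.2⟩, ?_⟩
      simp only [L.v₂_eq, add_sub_cancel_left, smul_smul, div_mul_cancel₀ s h0.ne']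

lemma carrier_subset_iff (L : TropLine) (X : Set Space) : L.carrier ⊆ X ↔
    (∀ i, ∀ s : ℝ, 0 ≤ s → L.base i + s • intVec (rayDir i) ∈ X) ∧
      ∀ s : ℝ, 0 ≤ s → s ≤ L.len → L.v₁ + s • intVec L.dir ∈ X := by
  simp only [carrier, Set.union_subset_iff, Set.iUnion_subset_iff, ray_eq_image, seg_eq_image,
    Set.image_subset_iff]
  constructor
  · exact fun h => ⟨fun i s hs => h.2 i hs, fun s h0 h1 => h.1 ⟨h0, h1⟩⟩
  · exact fun h => ⟨fun s hs => h.2 s hs.1 hs.2, fun i s hs => h.1 i s hs⟩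

lemma ray_subset_carrier (L : TropLine) (i : Fin 4) : L.ray i ⊆ L.carrier :=
  fun _ h => Or.inr (Set.mem_iUnion.2 ⟨i, h⟩)

lemma mem_carrier_of_ray (L : TropLine) (i : Fin 4) {s : ℝ} (hs : 0 ≤ s) :
    L.base i + s • intVec (rayDir i) ∈ L.carrier :=
  L.ray_subset_carrier i (by rw [ray_eq_image]; exact ⟨s, hs, rfl⟩)

lemma mem_carrier_of_seg (L : TropLine) {s : ℝ} (hs : 0 ≤ s) (hs' : s ≤ L.len) :
    L.v₁ + s • intVec L.dir ∈ L.carrier :=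
  Or.inl (by rw [seg_eq_image]; exact ⟨s, ⟨hs, hs'⟩, rfl⟩)

lemma carrier_congr {L L' : TropLine} (h : ∀ i, L.ray i = L'.ray i) (h' : L.seg = L'.seg) :
    L.carrier = L'.carrier := by
  simp only [carrier, h, h']

/-- The point set of a tropical line determines the lines spanned by its rays. -/
lemma exists_base_eq {L L' : TropLine} (h : L.carrier = L'.carrier) (i : Fin 4) :
    ∃ r : ℝ, L.base i = L'.base i + r • intVec (rayDir i) := by
  have hz : ∀ j, ∃ z : Space, j ≠ i → intVec (rayDir i) ⬝ᵥ z = 1 ∧ intVec (rayDir j) ⬝ᵥ z = 0 := by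
    intro j
    by_cases hj : j = i
    · exact ⟨0, fun h => absurd hj h⟩
    · obtain ⟨z, hz⟩ := exists_intVec_rayDir_dotProduct (Ne.symm hj)
      exact ⟨z, fun _ => hz⟩
  choose z hz using hz
  obtain ⟨k, hk⟩ := exists_ne i
  set B := ∑ j, |L'.base j ⬝ᵥ z j - L.base i ⬝ᵥ z j| with hB
  have hB' : ∀ j, L'.base j ⬝ᵥ z j - L.base i ⬝ᵥ z j ≤ B := fun j =>
    (le_abs_self _).trans (Finset.single_le_sum (f := fun j =>
      |L'.base j ⬝ᵥ z j - L.base i ⬝ᵥ z j|) (fun _ _ => abs_nonneg _) (Finset.mem_univ j))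
  have hB0 : 0 ≤ B := Finset.sum_nonneg fun _ _ => abs_nonneg _
  set c₁ := |L'.v₁ ⬝ᵥ z k - L.base i ⬝ᵥ z k| with hc₁
  set c₂ := |L'.v₂ ⬝ᵥ z k - L.base i ⬝ᵥ z k| with hc₂
  have h1 := le_abs_self (L'.v₁ ⬝ᵥ z k - L.base i ⬝ᵥ z k)
  have h2 := le_abs_self (L'.v₂ ⬝ᵥ z k - L.base i ⬝ᵥ z k)
  have h10 : 0 ≤ c₁ := abs_nonneg _
  have h20 : 0 ≤ c₂ := abs_nonneg _
  -- A point this far out on the ray `i` lies beyond `L'.seg`, measured by `z k`, and off every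
  -- other ray `j` of `L'`, on which `z j` is constant. It must lie on the ray `i` of `L'`.
  set s := B + c₁ + c₂ + 1 with hs
  have hp : L.base i + s • intVec (rayDir i) ∈ L'.carrier :=
    h ▸ L.mem_carrier_of_ray i (by linarith)
  rcases hp with hp | hp
  · exfalso
    have hlin := TropPoly.isLinearMap_dotProduct (z k)
    have hsub : L'.seg ⊆ {x | x ⬝ᵥ z k ≤ L.base i ⬝ᵥ z k + c₁ + c₂} := by
      refine (convex_halfSpace_le hlin _).segment_subset ?_ ?_ <;>
        simp only [Set.mem_ofPred_eq] <;> linarith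
    have := hsub hp
    simp only [Set.mem_ofPred_eq, add_dotProduct, smul_dotProduct, (hz k hk).1, smul_eq_mul,
      mul_one] at this
    linarith
  · obtain ⟨j, hj⟩ := Set.mem_iUnion.1 hp
    rw [ray_eq_image] at hj
    obtain ⟨s', hs', he⟩ := hj
    simp only at he
    by_cases hji : j = i
    · subst hji
      refine ⟨s' - s, ?_⟩
      rw [sub_smul, ← add_sub_assoc, he, add_sub_cancel_right]
    · exfalso
      have h3 := congrArg (fun x => x ⬝ᵥ z j) he
      simp only [add_dotProduct, smul_dotProduct, (hz j hji).1, (hz j hji).2, smul_eq_mul,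
        mul_one, mul_zero, add_zero] at h3
      have := hB' j
      linarith

lemma base_ofNear_of_mem {near : Finset (Fin 4)} (h : near.card = 2) (v : Space) {len : ℝ}
    (hlen : 0 ≤ len) {i : Fin 4} (hi : i ∈ near) : (ofNear near h v len hlen).base i = v :=
  if_pos hi

lemma base_ofNear_of_notMem {near : Finset (Fin 4)} (h : near.card = 2) (v : Space) {len : ℝ}
    (hlen : 0 ≤ len) {i : Fin 4} (hi : i ∉ near) :
    (ofNear near h v len hlen).base i = v + len • intVec (edgeDir near) :=
  if_neg hi

lemma card_compl_near {near : Finset (Fin 4)} (h : near.card = 2) : nearᶜ.card = 2 := by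
  rw [Finset.card_compl, h, Fintype.card_fin]

/-- Each vertex is the intersection of the two nonparallel lines spanned by its rays, and these
lines are determined by the point set. -/
lemma ofNear_inj {near : Finset (Fin 4)} {h : near.card = 2} {v v' : Space} {len len' : ℝ}
    {hlen : 0 ≤ len} {hlen' : 0 ≤ len'}
    (he : (ofNear near h v len hlen).carrier = (ofNear near h v' len' hlen').carrier) :
    v = v' ∧ len = len' := by
  have hpar := exists_base_eq he
  obtain ⟨i, j, hij, hn⟩ := Finset.card_eq_two.1 h
  obtain ⟨k, l, hkl, hn'⟩ := Finset.card_eq_two.1 (card_compl_near h)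
  have hi : i ∈ near := by simp [hn]
  have hj : j ∈ near := by simp [hn]
  have hk : k ∉ near := Finset.mem_compl.1 (by simp [hn'])
  have hl : l ∉ near := Finset.mem_compl.1 (by simp [hn'])
  obtain ⟨r₁, h₁⟩ := hpar i
  obtain ⟨r₂, h₂⟩ := hpar j
  obtain ⟨r₃, h₃⟩ := hpar k
  obtain ⟨r₄, h₄⟩ := hpar l
  rw [base_ofNear_of_mem _ _ _ hi, base_ofNear_of_mem _ _ _ hi] at h₁
  rw [base_ofNear_of_mem _ _ _ hj, base_ofNear_of_mem _ _ _ hj] at h₂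
  rw [base_ofNear_of_notMem _ _ _ hk, base_ofNear_of_notMem _ _ _ hk] at h₃
  rw [base_ofNear_of_notMem _ _ _ hl, base_ofNear_of_notMem _ _ _ hl] at h₄
  have hv : v = v' := sub_eq_zero.1 (eq_zero_of_smul_rayDir hij (r := r₁) (s := r₂)
    (by rw [h₁]; simp) (by rw [h₂]; simp))
  refine ⟨hv, ?_⟩
  have hw := eq_zero_of_smul_rayDir hkl (r := r₃) (s := r₄)
    (x := v + len • intVec (edgeDir near) - (v' + len' • intVec (edgeDir near)))
    (by rw [h₃]; simp) (by rw [h₄]; simp)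
  rw [hv, add_sub_add_left_eq_sub, ← sub_smul] at hw
  exact sub_eq_zero.1 ((smul_eq_zero.1 hw).resolve_right
    (ofNear near h v len hlen).dir_ne_zero)

/-- Exchanging the two vertices. -/
lemma ofNear_compl_base {near : Finset (Fin 4)} (h : near.card = 2) (v : Space) {len : ℝ}
    (hlen : 0 ≤ len) (i : Fin 4) :
    (ofNear nearᶜ (card_compl_near h) (v + len • intVec (edgeDir near)) len hlen).base i =
      (ofNear near h v len hlen).base i := by
  by_cases hi : i ∈ near
  · rw [base_ofNear_of_mem _ _ _ hi, base_ofNear_of_notMem _ _ _ (by simpa using hi),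
      edgeDir_compl, intVec_neg, smul_neg, add_neg_cancel_right]
  · rw [base_ofNear_of_notMem _ _ _ hi, base_ofNear_of_mem _ _ _ (by simpa using hi)]

lemma ray_congr {L L' : TropLine} {i : Fin 4} (h : L.base i = L'.base i) : L.ray i = L'.ray i := by
  rw [ray_eq_image, ray_eq_image, h]

lemma ofNear_compl_seg {near : Finset (Fin 4)} (h : near.card = 2) (v : Space) {len : ℝ}
    (hlen : 0 ≤ len) :
    (ofNear nearᶜ (card_compl_near h) (v + len • intVec (edgeDir near)) len hlen).seg =
      (ofNear near h v len hlen).seg := by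
  have : (ofNear nearᶜ (card_compl_near h) (v + len • intVec (edgeDir near)) len hlen).v₂ = v := by
    simp [ofNear, edgeDir_compl, intVec_neg]
  rw [seg, seg, this, segment_symm]
  rfl

lemma ofNear_compl_carrier {near : Finset (Fin 4)} (h : near.card = 2) (v : Space) {len : ℝ}
    (hlen : 0 ≤ len) :
    (ofNear nearᶜ (card_compl_near h) (v + len • intVec (edgeDir near)) len hlen).carrier =
      (ofNear near h v len hlen).carrier :=
  carrier_congr (fun i => ray_congr (ofNear_compl_base h v hlen i)) (ofNear_compl_seg h v hlen)

/-- Degenerate lines do not depend on the distribution of the rays. -/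
lemma ofNear_zero_base {near : Finset (Fin 4)} (h : near.card = 2) (v : Space) (i : Fin 4) :
    (ofNear near h v 0 le_rfl).base i = v := by
  by_cases hi : i ∈ near
  · rw [base_ofNear_of_mem _ _ _ hi]
  · rw [base_ofNear_of_notMem _ _ _ hi, zero_smul, add_zero]

lemma ofNear_zero_seg {near : Finset (Fin 4)} (h : near.card = 2) (v : Space) :
    (ofNear near h v 0 le_rfl).seg = {v} := by
  simp [seg, ofNear]

lemma ofNear_zero_carrier {near near' : Finset (Fin 4)} (h : near.card = 2) (h' : near'.card = 2)
    (v : Space) : (ofNear near h v 0 le_rfl).carrier = (ofNear near' h' v 0 le_rfl).carrier :=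
  carrier_congr (fun i => ray_congr (by rw [ofNear_zero_base, ofNear_zero_base]))
    (by rw [ofNear_zero_seg, ofNear_zero_seg])

end TropLine

/-! ### Two-point families -/

namespace TropPoly

open TropLine

variable {f : TropPoly}

/-- An affine family with nonzero velocity `(w, μ)` has pairwise distinct members by `ofNear_inj`,
and `L` is its member at `t = 0`. -/
lemma not_isIsolated_of_family {near : Finset (Fin 4)} {h : near.card = 2} {v w : Space}
    {len μ ε : ℝ} (hε : 0 < ε) (hlen : ∀ t ∈ Set.Icc 0 ε, 0 ≤ len + t * μ)
    (hX : ∀ t (ht : t ∈ Set.Icc 0 ε),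
      (ofNear near h (v + t • w) (len + t * μ) (hlen t ht)).carrier ⊆ f.surface)
    (hne : w = 0 → μ ≠ 0) {P Q : Space} (hPQ : P ≠ Q)
    (hPQX : ∀ t (ht : t ∈ Set.Icc 0 ε),
      P ∈ (ofNear near h (v + t • w) (len + t * μ) (hlen t ht)).carrier ∧
      Q ∈ (ofNear near h (v + t • w) (len + t * μ) (hlen t ht)).carrier)
    {L : TropLine} {hlen₀ : 0 ≤ len} (hL : L.carrier = (ofNear near h v len hlen₀).carrier) :
    ¬ f.IsIsolated L := by
  refine not_not_intro ⟨Set.range fun t : Set.Icc 0 ε =>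
    (ofNear near h (v + t.1 • w) (len + t.1 * μ) (hlen t.1 t.2)).carrier, ⟨?_, ?_, P, Q, hPQ, ?_⟩,
    ?_, ?_⟩
  · have : Infinite (Set.Icc 0 ε) := Set.Icc.infinite hε
    refine Set.infinite_range_of_injective fun s t hst => ?_
    obtain ⟨h1, h2⟩ := ofNear_inj hst
    by_contra hcon
    have hcon' : s.1 - t.1 ≠ 0 := sub_ne_zero.2 fun h => hcon (Subtype.ext h)
    have h3 : (s.1 - t.1) • w = 0 := by
      rw [sub_smul]; exact sub_eq_zero.2 (add_left_cancel h1)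
    have h4 : (s.1 - t.1) * μ = 0 := by linarith
    exact hne ((smul_eq_zero.1 h3).resolve_left hcon') ((mul_eq_zero.1 h4).resolve_left hcon')
  · rintro _ ⟨t, rfl⟩; exact ⟨_, rfl⟩
  · rintro _ ⟨t, rfl⟩; exact hPQX t.1 t.2
  · rintro _ ⟨t, rfl⟩; exact hX t.1 t.2
  · refine ⟨⟨0, le_rfl, hε.le⟩, ?_⟩
    rw [hL]
    simp

/-- A line on which two adjacent rays lie in one cell belongs to a two-point family. -/
lemma not_isIsolated_of_adjacent_rays {i j : Fin 4} (hij : i ≠ j) {v : Space} {len : ℝ}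
    (hlen : 0 ≤ len)
    (hX : (ofNear {i, j} (Finset.card_pair hij) v len hlen).carrier ⊆ f.surface)
    {M : Finset (Fin 3 → ℕ)} (hM : M.card = 2)
    (hi : ∀ s : ℝ, 0 ≤ s → M ⊆ f.active (v + s • intVec (rayDir i)))
    (hj : ∀ s : ℝ, 0 ≤ s → M ⊆ f.active (v + s • intVec (rayDir j))) {L : TropLine}
    (hL : L.carrier = (ofNear {i, j} (Finset.card_pair hij) v len hlen).carrier) :
    ¬ f.IsIsolated L := by
  set di := intVec (rayDir i) with hdi
  set dj := intVec (rayDir j) with hdj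
  have hD := edgeDir_pair hij
  rw [← hdi, ← hdj] at hD
  -- The cone spanned by the two rays lies in the surface, as every point of it is a midpoint of
  -- points of the rays. Moving `v` to `v + t • (di + dj)` prolongs the bounded edge by `t` and
  -- fixes the other vertex with its rays, one of which carries `P` and `Q`.
  have hcone : ∀ s t : ℝ, 0 ≤ s → 0 ≤ t → v + s • di + t • dj ∈ f.surface := by
    intro s t hs ht
    have hsub : M ⊆ f.active (v + s • di + t • dj) := by
      intro a ha
      have := mem_active_combo (hi (2 * s) (by linarith) ha) (hj (2 * t) (by linarith) ha)
        (s := 1 / 2) (t := 1 / 2) (by norm_num) (by norm_num) (by norm_num)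
      convert this using 2
      module
    obtain ⟨a, b, hab, rfl⟩ := Finset.card_eq_two.1 hM
    exact mem_surface_iff.2 ⟨a, b, hab, hsub (by simp), hsub (by simp)⟩
  obtain ⟨k, hk⟩ : ∃ k, k ∉ ({i, j} : Finset (Fin 4)) :=
    (by decide : ∀ i j : Fin 4, ∃ k, k ∉ ({i, j} : Finset (Fin 4))) i j
  obtain ⟨hXr, hXs⟩ := (carrier_subset_iff _ _).1 hX
  have hlen' : ∀ t ∈ Set.Icc (0 : ℝ) 1, 0 ≤ len + t * 1 := fun t ht => by linarith [ht.1]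
  have hfar : ∀ t (ht : t ∈ Set.Icc (0 : ℝ) 1), ∀ l ∉ ({i, j} : Finset (Fin 4)),
      (ofNear {i, j} (Finset.card_pair hij) (v + t • (di + dj)) (len + t * 1) (hlen' t ht)).base l =
        v + len • intVec (edgeDir {i, j}) := by
    intro t ht l hl
    rw [base_ofNear_of_notMem _ _ _ hl, hD]
    module
  refine not_isIsolated_of_family (w := di + dj) (μ := 1) one_pos hlen' ?_ (fun _ => one_ne_zero)
    (P := v + len • intVec (edgeDir {i, j}) + (0 : ℝ) • intVec (rayDir k))
    (Q := v + len • intVec (edgeDir {i, j}) + (1 : ℝ) • intVec (rayDir k)) ?_ ?_ hL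
  · intro t ht
    refine (carrier_subset_iff _ _).2 ⟨fun l s hs => ?_, fun s hs hs' => ?_⟩
    · by_cases hl : l ∈ ({i, j} : Finset (Fin 4))
      · rw [base_ofNear_of_mem _ _ _ hl]
        simp only [Finset.mem_insert, Finset.mem_singleton] at hl
        rcases hl with rfl | rfl
        · convert hcone (t + s) t (by linarith [ht.1]) ht.1 using 1
          module
        · convert hcone t (t + s) ht.1 (by linarith [ht.1]) using 1
          module
      · rw [hfar t ht l hl]
        have := hXr l s hs
        rwa [base_ofNear_of_notMem _ _ _ hl] at this
    · change s ≤ len + t * 1 at hs'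
      change v + t • (di + dj) + s • intVec (edgeDir {i, j}) ∈ f.surface
      rcases le_total t s with hts | hts
      · have := hXs (s - t) (by linarith) (by change s - t ≤ len; linarith)
        change v + (s - t) • intVec (edgeDir {i, j}) ∈ f.surface at this
        convert this using 1
        rw [hD]
        module
      · convert hcone (t - s) (t - s) (by linarith) (by linarith) using 1
        rw [hD]
        module
  · simp [intVec_rayDir_ne_zero]
  · intro t ht
    rw [← hfar t ht k hk]
    exact ⟨mem_carrier_of_ray _ k le_rfl, mem_carrier_of_ray _ k zero_le_one⟩

end TropPoly

/-! ### Interpolation between two lines -/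

namespace TropPoly

open TropLine

variable {f : TropPoly}

lemma genericSets_eq_of_cellsThrough_eq {l l' : Set Space} (hl : l ⊆ f.surface)
    (hl' : l' ⊆ f.surface) (h : f.cellsThrough l = f.cellsThrough l') :
    f.genericSets l = f.genericSets l' :=
  Set.Subset.antisymm (genericSets_subset_of_cellsThrough_eq hl hl' h)
    (genericSets_subset_of_cellsThrough_eq hl' hl h.symm)

lemma _root_.TropGeom.IsLevel.add {M : Finset (Fin 3 → ℕ)} {w d : Space} (hw : IsLevel M w)
    (hd : IsLevel M d) : IsLevel M (w + d) := fun a ha b hb => by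
  rw [dotProduct_add, dotProduct_add, hw a ha b hb, hd a ha b hb]

lemma _root_.TropGeom.IsLevel.smul {M : Finset (Fin 3 → ℕ)} {w : Space} (hw : IsLevel M w)
    (r : ℝ) : IsLevel M (r • w) := fun a ha b hb => by
  rw [dotProduct_smul, dotProduct_smul, hw a ha b hb]

/-- Two elementary triangles with a common edge, in the position dual to the vertices of a
moving tropical line, can only occur in degree at most two. -/
lemma degree_le_two_of_triangles {δ : ℕ} {i j k l : Fin 4} (hij : i ≠ j)
    (hkl : k ≠ l) (hsum : ∀ g : Fin 4 → ℤ, ∑ m, g m = g i + g j + g k + g l)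
    {S T : Finset (Fin 3 → ℕ)} (hS : IsElementary S) (hT : IsElementary T)
    {a b c e : Fin 3 → ℕ} (haS : a ∈ S) (hbS : b ∈ S) (hcS : c ∈ S)
    (haT : a ∈ T) (hbT : b ∈ T) (heT : e ∈ T) (hab : a ≠ b) (hac : a ≠ c) (hbc : b ≠ c)
    (hae : a ≠ e) (hbe : b ≠ e) (hia : bary δ i a = 0) (hic : bary δ i c = 0)
    (hjb : bary δ j b = 0) (hjc : bary δ j c = 0) (hka : bary δ k a = 0) (hke : bary δ k e = 0)
    (hlb : bary δ l b = 0) (hle : bary δ l e = 0) (hD : IsLevel {a, b} (intVec (edgeDir {i, j}))) :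
    δ ≤ 2 := by
  -- The edge direction is minus the sum of the ray directions `i` and `j`, so levelness says that
  -- the sum of the two coordinates agrees at `a` and `b`; one summand vanishes at each.
  have h1 : bary δ j a = bary δ i b := by
    have h2 := hD a (by simp) b (by simp)
    rw [edgeDir_pair hij, dotProduct_neg, dotProduct_neg, dotProduct_add, dotProduct_add] at h2
    have h3 : (bary δ i a + bary δ j a : ℝ) = bary δ i b + bary δ j b := by
      simp only [cast_bary]
      linarith
    have h4 : bary δ i a + bary δ j a = bary δ i b + bary δ j b := by exact_mod_cast h3
    linarith
  have hsa := hsum fun m => bary δ m a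
  have hsb := hsum fun m => bary δ m b
  simp only [sum_bary] at hsa hsb
  have h2 := hS.bary_dvd_one hij haS hbS hcS hab hac hbc hia hic hjb hjc h1
  have h3 := hT.bary_dvd_one hkl haT hbT heT hab hae hbe hka hke hlb hle (by linarith)
  have h4 := Int.le_of_dvd one_pos h2
  have h5 := Int.le_of_dvd one_pos h3
  have : (δ : ℤ) ≤ 2 := by linarith
  exact_mod_cast this

section Pencil

variable {near : Finset (Fin 4)} {h : near.card = 2} {v v' : Space} {len len' : ℝ}
  {hlen : 0 ≤ len} {hlen' : 0 ≤ len'}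

lemma interpolation_len_nonneg (hlen : 0 ≤ len) (hlen' : 0 ≤ len') {t : ℝ}
    (ht : t ∈ Set.Icc (0 : ℝ) 1) : 0 ≤ len + t * (len' - len) := by
  have h1 := mul_nonneg (sub_nonneg.2 ht.2) hlen
  have h2 := mul_nonneg ht.1 hlen'
  linarith

/-- The velocity of the starting point of a ray in the family of lines interpolating between two
lines of the same combinatorial type. -/
noncomputable def velocity (near : Finset (Fin 4)) (w : Space) (μ : ℝ) (i : Fin 4) : Space :=
  if i ∈ near then w else w + μ • intVec (edgeDir near)

lemma base_interpolation (t : ℝ) (w : Space) (μ : ℝ) (hlen : 0 ≤ len) (ht : 0 ≤ len + t * μ)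
    (i : Fin 4) : (ofNear near h (v + t • w) (len + t * μ) ht).base i =
      (ofNear near h v len hlen).base i + t • velocity near w μ i := by
  by_cases hi : i ∈ near
  · rw [base_ofNear_of_mem _ _ _ hi, base_ofNear_of_mem _ _ _ hi, velocity, if_pos hi]
  · rw [base_ofNear_of_notMem _ _ _ hi, base_ofNear_of_notMem _ _ _ hi, velocity, if_neg hi]
    module

/-- Corresponding rays and edges are parallel and meet the same cells, so each is interpolated
separately. The condition on the lengths excludes a segment shrinking to a point, whose direction
would carry no slope information. -/
lemma interpolation_subset_surface (hX : (ofNear near h v len hlen).carrier ⊆ f.surface)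
    (hX' : (ofNear near h v' len' hlen').carrier ⊆ f.surface)
    (hray : ∀ i, f.cellsThrough ((ofNear near h v' len' hlen').ray i) =
      f.cellsThrough ((ofNear near h v len hlen).ray i))
    (hseg : f.cellsThrough (ofNear near h v' len' hlen').seg =
      f.cellsThrough (ofNear near h v len hlen).seg)
    (h0 : len = 0 ↔ len' = 0) {t : ℝ} (ht : t ∈ Set.Icc (0 : ℝ) 1) :
    (ofNear near h (v + t • (v' - v)) (len + t * (len' - len))
      (interpolation_len_nonneg hlen hlen' ht)).carrier ⊆ f.surface := by
  rcases ht.1.eq_or_lt with rfl | ht0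
  · simpa using hX
  rcases ht.2.eq_or_lt with rfl | ht1
  · simpa using hX'
  have hnear : ∃ i, i ∈ near := Finset.card_pos.1 (by rw [h]; norm_num)
  have hrays : ∀ i, ∀ s : ℝ, 0 ≤ s → (ofNear near h (v + t • (v' - v)) (len + t * (len' - len))
      (interpolation_len_nonneg hlen hlen' ht)).base i + s • intVec (rayDir i) ∈ f.surface := by
    intro i s hs
    have hg := genericSets_eq_of_cellsThrough_eq
      ((ray_subset_carrier _ i).trans hX) ((ray_subset_carrier _ i).trans hX') (hray i).symm
    rw [ray_eq_image, ray_eq_image] at hg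
    have := interpolate_mem_surface (convex_Ici (0 : ℝ)) (convex_Ici (0 : ℝ))
      ⟨0, Set.self_mem_Ici, 1, Set.mem_Ici.2 zero_le_one, zero_ne_one⟩
      (by rw [← ray_eq_image]; exact (ray_subset_carrier _ i).trans hX) hg
      (sub_pos.2 ht1) ht0 (by ring) (s := s) (s' := s) hs hs
    convert this using 1
    by_cases hi : i ∈ near
    · simp only [base_ofNear_of_mem _ _ _ hi]; module
    · simp only [base_ofNear_of_notMem _ _ _ hi]; module
  refine (carrier_subset_iff _ _).2 ⟨hrays, fun s hs hs' => ?_⟩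
  change s ≤ len + t * (len' - len) at hs'
  by_cases hl : len = 0
  · have hs0 : s = 0 := le_antisymm (by rw [hl, h0.1 hl] at hs'; linarith) hs
    obtain ⟨i, hi⟩ := hnear
    have := hrays i 0 le_rfl
    rw [base_ofNear_of_mem _ _ _ hi] at this
    rw [hs0, zero_smul]
    rwa [zero_smul] at this
  · have hl0 : 0 < len := lt_of_le_of_ne hlen (Ne.symm hl)
    have hl0' : 0 < len' := lt_of_le_of_ne hlen' fun h => hl (h0.2 h.symm)
    have hg := genericSets_eq_of_cellsThrough_eq
      (Set.subset_union_left.trans hX) (Set.subset_union_left.trans hX') hseg.symm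
    have hX1 := Set.subset_union_left.trans hX
    rw [seg_eq_image] at hX1
    rw [seg_eq_image, seg_eq_image] at hg
    set m := len + t * (len' - len) with hm
    have hm0 : 0 < m := by nlinarith
    have hθ0 : 0 ≤ s / m := div_nonneg hs hm0.le
    have hθ1 : s / m ≤ 1 := (div_le_one hm0).2 hs'
    -- The point at fraction `s / m` of the interpolated edge is the weighted mean of the points at
    -- the same fraction of the two given edges.
    have := interpolate_mem_surface (convex_Icc 0 len) (convex_Icc 0 len')
      ⟨0, ⟨le_rfl, hl0.le⟩, len, ⟨hl0.le, le_rfl⟩, hl0.ne⟩ hX1 hg (sub_pos.2 ht1) ht0 (by ring)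
      (s := s / m * len) (s' := s / m * len')
      ⟨by positivity, by nlinarith⟩ ⟨by positivity, by nlinarith⟩
    convert this using 1
    change v + t • (v' - v) + s • intVec (edgeDir near) =
      (1 - t) • (v + (s / m * len) • intVec (edgeDir near)) +
        t • (v' + (s / m * len') • intVec (edgeDir near))
    have hsm : s = (1 - t) * (s / m * len) + t * (s / m * len') := by
      have : s = s / m * m := (div_mul_cancel₀ s hm0.ne').symm
      conv_lhs => rw [this]
      rw [hm]; ring
    conv_lhs => rw [hsm]
    module

end Pencil

/-! ### Moving lines are not isolated -/

/-- A moving line on a smooth surface of degree at least three is not isolated. -/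
theorem not_isIsolated_of_pencil {δ : ℕ} (hδ : 3 ≤ δ) (hdeg : f.HasDegree δ) (hf : f.IsSmooth)
    {near : Finset (Fin 4)} {h : near.card = 2} {v w : Space} {len μ : ℝ} (hlen₀ : 0 ≤ len)
    (hlen : ∀ t ∈ Set.Icc (0 : ℝ) 1, 0 ≤ len + t * μ)
    (hX : ∀ t (ht : t ∈ Set.Icc (0 : ℝ) 1),
      (ofNear near h (v + t • w) (len + t * μ) (hlen t ht)).carrier ⊆ f.surface)
    (h0 : len = 0 ↔ len + μ = 0) (hne : w = 0 → μ ≠ 0) {L : TropLine}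
    (hL : L.carrier = (ofNear near h v len hlen₀).carrier) : ¬ f.IsIsolated L := by
  intro hiso
  set L₀ := ofNear near h v len hlen₀ with hL₀
  have hX0 : L₀.carrier ⊆ f.surface := by
    have := hX 0 ⟨le_rfl, zero_le_one⟩
    simpa using this
  have hbase : ∀ t (ht : t ∈ Set.Icc (0 : ℝ) 1) i,
      (ofNear near h (v + t • w) (len + t * μ) (hlen t ht)).base i =
        L₀.base i + t • velocity near w μ i := fun t ht i =>
    base_interpolation t w μ hlen₀ (hlen t ht) i
  -- a vertex moves along an adjacent ray
  by_cases hpar : ∃ i, crossProduct (velocity near w μ i) (intVec (rayDir i)) = 0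
  · obtain ⟨i, hi⟩ := hpar
    obtain ⟨r, hr⟩ := exists_smul_of_crossProduct_eq_zero (intVec_rayDir_ne_zero i) hi
    -- The starting point moves by `t * r ≤ |r|` along the ray, so points beyond `|r|` stay on the
    -- ray throughout.
    have hmem : ∀ c : ℝ, 0 ≤ c → ∀ t (ht : t ∈ Set.Icc (0 : ℝ) 1),
        L₀.base i + (|r| + c) • intVec (rayDir i) ∈
          (ofNear near h (v + t • w) (len + t * μ) (hlen t ht)).carrier := by
      intro c hc t ht
      have h1 : 0 ≤ |r| + c - t * r := by
        have h2 := le_abs_self r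
        have h3 := abs_nonneg r
        have : t * r ≤ |r| := (mul_le_mul_of_nonneg_left h2 ht.1).trans
          (mul_le_of_le_one_left h3 ht.2)
        linarith
      convert mem_carrier_of_ray _ i h1 using 1
      rw [hbase t ht, hr]
      module
    refine not_isIsolated_of_family one_pos hlen hX hne
      (P := L₀.base i + (|r| + 0) • intVec (rayDir i))
      (Q := L₀.base i + (|r| + 1) • intVec (rayDir i)) ?_
      (fun t ht => ⟨hmem 0 le_rfl t ht, hmem 1 zero_le_one t ht⟩) hL hiso
    intro heq
    have := add_left_cancel heq
    have h2 : (1 : ℝ) • intVec (rayDir i) = 0 := by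
      rw [add_zero, add_smul] at this
      exact left_eq_add.1 this
    rw [one_smul] at h2
    exact intVec_rayDir_ne_zero i h2
  push Not at hpar
  have hw_ne : ∀ i, velocity near w μ i ≠ 0 := fun i hi => hpar i (by rw [hi]; simp)
  -- the cells swept out by the rays
  have hM : ∀ i, ∃ M : Finset (Fin 3 → ℕ), M.card = 2 ∧ IsLevel M (velocity near w μ i) ∧
      IsLevel M (intVec (rayDir i)) ∧ ∀ t s : ℝ, t ∈ Set.Icc (0 : ℝ) 1 → 0 ≤ s →
        M ⊆ f.active (L₀.base i + t • velocity near w μ i + s • intVec (rayDir i)) := by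
    intro i
    obtain ⟨M, h1, h2, h3, h4⟩ := hf.exists_pair_of_plane (p := L₀.base i) (hpar i)
      (R := Set.Ioo (0 : ℝ) 1 ×ˢ Set.Ioi (0 : ℝ)) (isOpen_Ioo.prod isOpen_Ioi)
      ((convex_Ioo _ _).prod (convex_Ioi _)) ⟨(1 / 2, 1), by norm_num⟩ (by
        rintro ⟨t, s⟩ ⟨ht, hs⟩
        have ht' : t ∈ Set.Icc (0 : ℝ) 1 := ⟨ht.1.le, ht.2.le⟩
        have := ((carrier_subset_iff _ _).1 (hX t ht')).1 i s (le_of_lt hs)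
        rwa [hbase t ht'] at this)
    refine ⟨M, h1, h2, h3, fun t s ht hs => h4 (t, s) ?_⟩
    rw [closure_prod_eq, closure_Ioo zero_ne_one, closure_Ioi]
    exact ⟨ht, hs⟩
  choose M hMc hMw hMd hMa using hM
  have hMray : ∀ i, ∀ s : ℝ, 0 ≤ s → M i ⊆ f.active (L₀.base i + s • intVec (rayDir i)) := by
    intro i s hs
    have := hMa i 0 s ⟨le_rfl, zero_le_one⟩ hs
    rwa [zero_smul, add_zero] at this
  have hhalf : (1 / 2 : ℝ) ∈ Set.Icc (0 : ℝ) 1 := by norm_num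
  have hMhalf : ∀ i, M i ⊆ f.active (L₀.base i + (1 / 2 : ℝ) • velocity near w μ i) := by
    intro i
    have := hMa i (1 / 2) 0 hhalf le_rfl
    rwa [zero_smul, add_zero] at this
  rcases eq_or_ne len 0 with hl | hl
  · -- degenerate lines
    have hμ : μ = 0 := by have := h0.1 hl; linarith
    have hv : ∀ i, velocity near w μ i = w := fun i => by simp [velocity, hμ]
    have hb : ∀ i, L₀.base i = v := fun i => by
      rw [hL₀]; subst hl; exact ofNear_zero_base h v i
    have hne' : ∀ i j, i ≠ j → M i ≠ M j := by
      intro i j hij hMM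
      have hc : L₀.carrier = (ofNear {i, j} (Finset.card_pair hij) v 0 le_rfl).carrier := by
        rw [hL₀]; subst hl; exact ofNear_zero_carrier _ _ v
      refine not_isIsolated_of_adjacent_rays hij le_rfl (hc ▸ hX0) (hMc i) ?_ ?_ (hL.trans hc) hiso
      · intro s hs; have := hMray i s hs; rwa [hb] at this
      · intro s hs; have := hMray j s hs; rwa [hb, ← hMM] at this
    have hMS : ∀ i, M i ⊆ f.active (v + (1 / 2 : ℝ) • w) := fun i => by
      have := hMhalf i; rwa [hb, hv] at this
    have hMw' : ∀ i, IsLevel (M i) w := fun i => hv i ▸ hMw i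
    have hw : w ≠ 0 := hv 0 ▸ hw_ne 0
    -- Both remaining rays would have to sweep out the cell of the third side of the triangle
    -- determined by the rays `0` and `1`.
    have htri : ∀ i, i ≠ 0 → i ≠ 1 → M i = symmDiff (M 0) (M 1) := fun i hi0 hi1 =>
      (hf.isElementary (v + (1 / 2 : ℝ) • w)).eq_symmDiff hw (hMS 0) (hMS 1) (hMS i) (hMc 0)
        (hMc 1) (hMc i) (hne' 0 1 (by decide)) (hne' 0 i hi0.symm) (hne' 1 i hi1.symm) (hMw' 0)
        (hMw' 1) (hMw' i)
    exact hne' 2 3 (by decide) ((htri 2 (by decide) (by decide)).trans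
      (htri 3 (by decide) (by decide)).symm)
  -- nondegenerate lines
  have hl0 : 0 < len := lt_of_le_of_ne hlen₀ (Ne.symm hl)
  have hl1 : 0 < len + μ := by
    have h1 := hlen 1 ⟨zero_le_one, le_rfl⟩
    rw [one_mul] at h1
    exact lt_of_le_of_ne h1 fun h => hl (h0.2 h.symm)
  have hpos : ∀ t ∈ Set.Icc (0 : ℝ) 1, 0 < len + t * μ := fun t ht => by
    rcases ht.1.eq_or_lt with rfl | h1
    · simpa using hl0
    · have := mul_pos h1 hl1
      nlinarith [ht.2]
  have hD0 : intVec (edgeDir near) ≠ 0 := L₀.dir_ne_zero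
  have hXseg : ∀ t ∈ Set.Icc (0 : ℝ) 1, ∀ s, 0 ≤ s → s ≤ len + t * μ →
      v + t • w + s • intVec (edgeDir near) ∈ f.surface := fun t ht s hs hs' =>
    ((carrier_subset_iff _ _).1 (hX t ht)).2 s hs hs'
  by_cases hparD : crossProduct w (intVec (edgeDir near)) = 0
  · obtain ⟨r, hr⟩ := exists_smul_of_crossProduct_eq_zero hD0 hparD
    -- The edge slides along its own line and each end moves with speed less than `K`. For `t ≤ len
    -- / (3 * K)` its middle third is therefore common to all the lines.
    set K := |r| + |μ| + 1 with hK
    have hr0 := abs_nonneg r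
    have hμ0 := abs_nonneg μ
    have hK0 : 0 < K := by linarith
    have hε : 0 < min 1 (len / (3 * K)) := lt_min one_pos (by positivity)
    have hsub : ∀ t ∈ Set.Icc 0 (min 1 (len / (3 * K))), t ∈ Set.Icc (0 : ℝ) 1 := fun t ht =>
      ⟨ht.1, ht.2.trans (min_le_left _ _)⟩
    have hmem : ∀ c, len / 3 ≤ c → c ≤ 2 * len / 3 →
        ∀ t (ht : t ∈ Set.Icc 0 (min 1 (len / (3 * K)))), v + c • intVec (edgeDir near) ∈
          (ofNear near h (v + t • w) (len + t * μ) (hlen t (hsub t ht))).carrier := by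
      intro c hc hc' t ht
      have h1 : t ≤ len / (3 * K) := ht.2.trans (min_le_right _ _)
      rw [le_div_iff₀ (by positivity)] at h1
      have h2 : t * r ≤ t * |r| := mul_le_mul_of_nonneg_left (le_abs_self r) ht.1
      have h3 : t * (-r) ≤ t * |r| := mul_le_mul_of_nonneg_left (neg_le_abs r) ht.1
      have h4 : t * (-μ) ≤ t * |μ| := mul_le_mul_of_nonneg_left (neg_le_abs μ) ht.1
      have h5 := mul_nonneg ht.1 hr0
      have h6 := mul_nonneg ht.1 hμ0
      have h7 : t * (3 * K) = 3 * (t * |r|) + 3 * (t * |μ|) + 3 * t := by rw [hK]; ring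
      have h8 := ht.1
      have h9 := mem_carrier_of_seg
        (ofNear near h (v + t • w) (len + t * μ) (hlen t (hsub t ht))) (s := c - t * r)
        (by linarith) (by change c - t * r ≤ len + t * μ; linarith)
      convert h9 using 1
      change _ = v + t • w + (c - t * r) • intVec (edgeDir near)
      rw [hr]
      module
    refine not_isIsolated_of_family hε (fun t ht => hlen t (hsub t ht))
      (fun t ht => hX t (hsub t ht)) hne (P := v + (len / 3) • intVec (edgeDir near))
      (Q := v + (2 * len / 3) • intVec (edgeDir near)) ?_ (fun t ht =>
        ⟨hmem _ le_rfl (by linarith) t ht, hmem _ (by linarith) le_rfl t ht⟩) hL hiso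
    intro heq
    have h1 := smul_left_injective ℝ hD0 (add_left_cancel heq)
    linarith
  -- the cell swept out by the bounded edge
  obtain ⟨N, hNc, hNw, hNd, hNa⟩ : ∃ N : Finset (Fin 3 → ℕ), N.card = 2 ∧ IsLevel N w ∧
      IsLevel N (intVec (edgeDir near)) ∧ ∀ s, 0 ≤ s → s ≤ len + 1 / 2 * μ →
        N ⊆ f.active (v + (1 / 2 : ℝ) • w + s • intVec (edgeDir near)) := by
    have hm := hpos (1 / 2) hhalf
    set R : Set (ℝ × ℝ) := {z | (0 < z.1 ∧ z.1 < 1) ∧ 0 < z.2 ∧ z.2 < len + z.1 * μ} with hR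
    have hRo : IsOpen R :=
      ((isOpen_lt continuous_const continuous_fst).and
        (isOpen_lt continuous_fst continuous_const)).and
      ((isOpen_lt continuous_const continuous_snd).and (isOpen_lt continuous_snd
        (continuous_const.add (continuous_fst.mul continuous_const))))
    have hRc : Convex ℝ R := by
      rintro ⟨x, y⟩ ⟨⟨h1, h2⟩, h3, h4⟩ ⟨x', y'⟩ ⟨⟨h1', h2'⟩, h3', h4'⟩ a b ha hb hab
      simp only at h1 h2 h3 h4 h1' h2' h3' h4'
      have comb : ∀ p q : ℝ, 0 < p → 0 < q → 0 < a * p + b * q := fun p q hp hq => by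
        rcases ha.eq_or_lt with rfl | ha'
        · rw [zero_add] at hab; subst hab; simpa using hq
        · have := mul_pos ha' hp
          have := mul_nonneg hb hq.le
          linarith
      have g1 := comb _ _ h1 h1'
      have g2 := comb _ _ (sub_pos.2 h2) (sub_pos.2 h2')
      have g3 := comb _ _ h3 h3'
      have g4 := comb _ _ (sub_pos.2 h4) (sub_pos.2 h4')
      refine ⟨⟨?_, ?_⟩, ?_, ?_⟩ <;>
        simp only [Prod.smul_mk, Prod.mk_add_mk, smul_eq_mul]
      · exact g1
      · linarith
      · exact g3
      · have : len = a * len + b * len := by rw [← add_mul, hab, one_mul]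
        linarith
    obtain ⟨N, h1, h2, h3, h4⟩ := hf.exists_pair_of_plane (p := v) hparD hRo hRc
      ⟨(1 / 2, (len + 1 / 2 * μ) / 2), ⟨by norm_num, by norm_num⟩, half_pos hm, half_lt_self hm⟩
      (fun z hz => hXseg z.1 ⟨hz.1.1.le, hz.1.2.le⟩ z.2 hz.2.1.le hz.2.2.le)
    refine ⟨N, h1, h2, h3, fun s hs hs' => h4 (1 / 2, s) ?_⟩
    have hcont : Continuous fun s : ℝ => ((1 / 2 : ℝ), s) := by fun_prop
    refine map_mem_closure (f := fun s : ℝ => ((1 / 2 : ℝ), s)) (s := Set.Ioo 0 (len + 1 / 2 * μ))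
      hcont ?_ ?_
    · rw [closure_Ioo hm.ne]; exact ⟨hs, hs'⟩
    · exact fun s hs => ⟨⟨by norm_num, by norm_num⟩, hs⟩
  obtain ⟨i, j, hij, hn⟩ := Finset.card_eq_two.1 h
  obtain ⟨k, l, hkl, hn'⟩ := Finset.card_eq_two.1 (card_compl_near h)
  have hi : i ∈ near := by simp [hn]
  have hj : j ∈ near := by simp [hn]
  have hk : k ∉ near := Finset.mem_compl.1 (by simp [hn'])
  have hl : l ∉ near := Finset.mem_compl.1 (by simp [hn'])
  have hvel : ∀ m ∈ near, velocity near w μ m = w := fun m hm => if_pos hm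
  have hvel' : ∀ m ∉ near, velocity near w μ m = w + μ • intVec (edgeDir near) :=
    fun m hm => if_neg hm
  have hbn : ∀ m ∈ near, L₀.base m = v := fun m hm => base_ofNear_of_mem _ _ _ hm
  have hbf : ∀ m ∉ near, L₀.base m = v + len • intVec (edgeDir near) :=
    fun m hm => base_ofNear_of_notMem _ _ _ hm
  set S := f.active (v + (1 / 2 : ℝ) • w) with hS
  set T := f.active (v + (1 / 2 : ℝ) • w + (len + 1 / 2 * μ) • intVec (edgeDir near)) with hT
  have hMS : ∀ m ∈ near, M m ⊆ S := fun m hm => by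
    have := hMhalf m; rwa [hbn m hm, hvel m hm] at this
  have hMT : ∀ m ∉ near, M m ⊆ T := fun m hm => by
    have h1 := hMhalf m
    rw [hbf m hm, hvel' m hm] at h1
    convert h1 using 2
    module
  have hNS : N ⊆ S := by
    have := hNa 0 le_rfl (hpos _ hhalf).le
    rwa [zero_smul, add_zero] at this
  have hNT : N ⊆ T := hNa _ (hpos _ hhalf).le le_rfl
  have hMij : M i ≠ M j := by
    intro hMM
    subst hn
    refine not_isIsolated_of_adjacent_rays hij hlen₀ hX0 (hMc i) ?_ ?_ hL hiso
    · intro s hs; have := hMray i s hs; rwa [hbn i hi] at this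
    · intro s hs; have := hMray j s hs; rwa [hbn j hj, ← hMM] at this
  have hMkl : M k ≠ M l := by
    intro hMM
    have hc : L₀.carrier = (ofNear {k, l} (Finset.card_pair hkl)
        (v + len • intVec (edgeDir near)) len hlen₀).carrier := by
      rw [hL₀, ← ofNear_compl_carrier]
      congr 1
      congr 1
    refine not_isIsolated_of_adjacent_rays hkl hlen₀ (hc ▸ hX0) (hMc k) ?_ ?_ (hL.trans hc) hiso
    · intro s hs; have := hMray k s hs; rwa [hbf k hk] at this
    · intro s hs; have := hMray l s hs; rwa [hbf l hl, ← hMM] at this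
  have hSe : IsElementary S := hf.isElementary _
  have hTe : IsElementary T := hf.isElementary _
  have hDij : intVec (edgeDir near) = -(intVec (rayDir i) + intVec (rayDir j)) := by
    rw [hn, edgeDir_pair hij]
  have hDkl : intVec (edgeDir near) = intVec (rayDir k) + intVec (rayDir l) := by
    have h1 := edgeDir_compl near
    have h2 := edgeDir_pair hkl
    rw [← hn', h1, intVec_neg] at h2
    exact neg_injective h2
  -- Rays at the same vertex have the same velocity, so if the pair of one is also level along the
  -- other, both pairs are orthogonal to the same plane and hence equal.
  have hadj : ∀ {U : Finset (Fin 3 → ℕ)} {m m' : Fin 4}, IsElementary U → M m ⊆ U → M m' ⊆ U →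
      velocity near w μ m = velocity near w μ m' → IsLevel (M m) (intVec (rayDir m')) →
      M m = M m' := fun hU hm hm' hvv hlev =>
    hU.eq_of_isLevel (hpar _) hm hm' (hMc _) (hMc _) (hvv ▸ hMw _) hlev (hMw _) (hMd _)
  -- A pair level along one ray and along the bounded edge is level along the other ray at that
  -- vertex, by balancing. The next three claims follow in the same way.
  have hNi : M i ≠ N := by
    intro hMN
    refine hMij (hadj hSe (hMS i hi) (hMS j hj) (by rw [hvel i hi, hvel j hj]) ?_)
    have : intVec (rayDir j) = (-1 : ℝ) • intVec (rayDir i) + (-1 : ℝ) • intVec (edgeDir near) := by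
      rw [hDij]; module
    rw [this]
    exact ((hMd i).smul _).add ((hMN ▸ hNd).smul _)
  have hNj : M j ≠ N := by
    intro hMN
    refine hMij (hadj hSe (hMS j hj) (hMS i hi) (by rw [hvel i hi, hvel j hj]) ?_).symm
    have : intVec (rayDir i) = (-1 : ℝ) • intVec (rayDir j) + (-1 : ℝ) • intVec (edgeDir near) := by
      rw [hDij]; module
    rw [this]
    exact ((hMd j).smul _).add ((hMN ▸ hNd).smul _)
  have hNk : M k ≠ N := by
    intro hMN
    refine hMkl (hadj hTe (hMT k hk) (hMT l hl) (by rw [hvel' k hk, hvel' l hl]) ?_)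
    have : intVec (rayDir l) = (-1 : ℝ) • intVec (rayDir k) + (1 : ℝ) • intVec (edgeDir near) := by
      rw [hDkl]; module
    rw [this]
    exact ((hMd k).smul _).add ((hMN ▸ hNd).smul _)
  have hNl : M l ≠ N := by
    intro hMN
    refine hMkl (hadj hTe (hMT l hl) (hMT k hk) (by rw [hvel' k hk, hvel' l hl]) ?_).symm
    have : intVec (rayDir k) = (-1 : ℝ) • intVec (rayDir l) + (1 : ℝ) • intVec (edgeDir near) := by
      rw [hDkl]; module
    rw [this]
    exact ((hMd l).smul _).add ((hMN ▸ hNd).smul _)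
  obtain ⟨a, b, c, hab, hac, hbc, hMi, hMj, hN⟩ := hSe.exists_triangle (hvel i hi ▸ hw_ne i)
    (hMS i hi) (hMS j hj) hNS (hMc i) (hMc j) hNc hMij hNi hNj (hvel i hi ▸ hMw i)
    (hvel j hj ▸ hMw j) hNw
  -- `N` is level along `w` and along the edge, hence also along the velocity `w + μ • intVec
  -- (edgeDir near)` of the second vertex.
  obtain ⟨a', b', c', hab', hac', hbc', hMk, hMl, hN'⟩ := hTe.exists_triangle
    (hvel' k hk ▸ hw_ne k) (hMT k hk) (hMT l hl) hNT (hMc k) (hMc l) hNc hMkl hNk hNl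
    (hvel' k hk ▸ hMw k) (hvel' l hl ▸ hMw l) (hNw.add (hNd.smul μ))
  have hface : ∀ m, ∀ x ∈ M m, bary δ m x = 0 := fun m x hx =>
    hdeg.bary_eq_zero fun s hs => hMa m 0 s ⟨le_rfl, zero_le_one⟩ hs hx
  have hsum : ∀ g : Fin 4 → ℤ, ∑ m, g m = g i + g j + g k + g l := by
    intro g
    rw [← Finset.sum_add_sum_compl near, hn', hn, Finset.sum_pair hij, Finset.sum_pair hkl]
    ring
  have hfi : ∀ x ∈ ({a, c} : Finset _), bary δ i x = 0 ∧ x ∈ S := hMi ▸ fun x hx =>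
    ⟨hface i x hx, hMS i hi hx⟩
  have hfj : ∀ x ∈ ({b, c} : Finset _), bary δ j x = 0 ∧ x ∈ S := hMj ▸ fun x hx =>
    ⟨hface j x hx, hMS j hj hx⟩
  have hfk : ∀ x ∈ ({a', c'} : Finset _), bary δ k x = 0 ∧ x ∈ T := hMk ▸ fun x hx =>
    ⟨hface k x hx, hMT k hk hx⟩
  have hfl : ∀ x ∈ ({b', c'} : Finset _), bary δ l x = 0 ∧ x ∈ T := hMl ▸ fun x hx =>
    ⟨hface l x hx, hMT l hl hx⟩
  have hia := hfi a (by simp)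
  have hic := hfi c (by simp)
  have hjb := hfj b (by simp)
  have hjc := hfj c (by simp)
  have hka := hfk a' (by simp)
  have hkc := hfk c' (by simp)
  have hlb := hfl b' (by simp)
  have hlc := hfl c' (by simp)
  have hNd' : IsLevel {a, b} (intVec (edgeDir {i, j})) := by rw [← hN, ← hn]; exact hNd
  have hle : δ ≤ 2 := by
    -- The two triangles share the side `N`, but its ends may be matched in either order; the second
    -- order amounts to exchanging `k` and `l`.
    have ha' : a' = a ∨ a' = b := by
      have : a' ∈ ({a, b} : Finset _) := by rw [← hN, hN']; simp
      simpa using this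
    have hb' : b' = a ∨ b' = b := by
      have : b' ∈ ({a, b} : Finset _) := by rw [← hN, hN']; simp
      simpa using this
    rcases ha' with rfl | rfl <;> rcases hb' with rfl | rfl
    · exact absurd rfl hab'
    · exact degree_le_two_of_triangles hij hkl hsum hSe hTe hia.2 hjb.2 hic.2 hka.2 hlb.2 hkc.2
        hab hac hbc hac' hbc' hia.1 hic.1 hjb.1 hjc.1 hka.1 hkc.1 hlb.1 hlc.1 hNd'
    · exact degree_le_two_of_triangles hij hkl.symm (fun g => by rw [hsum g]; ring) hSe hTe
        hia.2 hjb.2 hic.2 hlb.2 hka.2 hkc.2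
        hab hac hbc hbc' hac' hia.1 hic.1 hjb.1 hjc.1 hlb.1 hlc.1 hka.1 hkc.1 hNd'
    · exact absurd rfl hab'
  omega

/-! ### Conclusion from the combinatorial data -/

/-- Two lines in the surface of the same type and through the same cells coincide if the first one
is isolated. -/
lemma carrier_eq_of_cellsThrough_eq {δ : ℕ} (hδ : 3 ≤ δ) (hdeg : f.HasDegree δ) (hf : f.IsSmooth)
    {L L' : TropLine} (hX : L.carrier ⊆ f.surface) (hX' : L'.carrier ⊆ f.surface)
    (hiso : f.IsIsolated L) (hnear : L'.near = L.near)
    (hray : ∀ i, f.cellsThrough (L'.ray i) = f.cellsThrough (L.ray i))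
    (hseg : f.cellsThrough L'.seg = f.cellsThrough L.seg) (h0 : L.len = 0 ↔ L'.len = 0) :
    L'.carrier = L.carrier := by
  have hL := L.eq_ofNear
  have hL' : L' = ofNear L.near L.card_near L'.v₁ L'.len L'.len_nonneg := by
    conv_lhs => rw [L'.eq_ofNear]
    congr 1
  by_cases heq : L'.v₁ - L.v₁ = 0 ∧ L'.len - L.len = 0
  · have h1 := sub_eq_zero.1 heq.1
    have h2 := sub_eq_zero.1 heq.2
    rw [hL', hL]
    simp only [h1, h2]
    rfl
  · exfalso
    rw [hL] at hX hray hseg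
    rw [hL'] at hX' hray hseg
    refine not_isIsolated_of_pencil hδ hdeg hf L.len_nonneg
      (fun t ht => interpolation_len_nonneg L.len_nonneg L'.len_nonneg ht)
      (fun t ht => interpolation_subset_surface hX hX' hray hseg h0 ht) ?_
      (fun h h' => heq ⟨h, h'⟩) (congrArg carrier hL) hiso
    rw [h0, add_sub_cancel]

/-- An isolated tropical line is determined by its combinatorial data. -/
theorem carrier_eq_of_data_eq {δ : ℕ} (hδ : 3 ≤ δ) (hdeg : f.HasDegree δ) (hsmooth : f.IsSmooth)
    {L L' : TropLine} (hL : L.carrier ⊆ f.surface) (hiso : f.IsIsolated L)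
    (hL' : L'.carrier ⊆ f.surface) (hdata : f.data L' = f.data L) :
    L'.carrier = L.carrier := by
  have hray : ∀ i, f.cellsThrough (L'.ray i) = f.cellsThrough (L.ray i) :=
    congrFun (congrArg CombData.rayCells hdata)
  have hseg : f.cellsThrough L'.seg = f.cellsThrough L.seg := congrArg CombData.segCells hdata
  have hkappa : L'.combType = L.combType := congrArg CombData.kappa hdata
  -- It suffices to redescribe `L'` with the distribution of rays of `L`: for degenerate lines any
  -- distribution will do, and otherwise at most the two vertices have to be exchanged.
  suffices hex : ∃ L'' : TropLine, (∀ i, L''.ray i = L'.ray i) ∧ L''.seg = L'.seg ∧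
      L''.near = L.near ∧ (L.len = 0 ↔ L''.len = 0) by
    obtain ⟨L'', h1, h2, h3, h4⟩ := hex
    rw [← carrier_congr h1 h2]
    exact carrier_eq_of_cellsThrough_eq hδ hdeg hsmooth hL (carrier_congr h1 h2 ▸ hL') hiso h3
      (fun i => by rw [h1, hray]) (by rw [h2, hseg]) h4
  have hunivne : ∀ L : TropLine, L.near ≠ Finset.univ := fun L h => by
    have := L.card_near
    simp [h] at this
  unfold combType at hkappa
  split_ifs at hkappa with h1 h2 h2
  · have hl' := L'.v₁_eq_v₂_iff.1 h1
    have hl := L.v₁_eq_v₂_iff.1 h2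
    have he : L' = ofNear L'.near L'.card_near L'.v₁ 0 le_rfl := by
      conv_lhs => rw [L'.eq_ofNear]
      simp only [hl']
    refine ⟨ofNear L.near L.card_near L'.v₁ 0 le_rfl, fun i => ?_, ?_, rfl, by simp [hl, ofNear]⟩
    · rw [he]
      exact ray_congr (by rw [ofNear_zero_base, ofNear_zero_base]; rfl)
    · rw [he, ofNear_zero_seg, ofNear_zero_seg]; rfl
  · have : L.near ∈ ({Finset.univ} : Finset (Finset (Fin 4))) := by rw [hkappa]; simp
    exact absurd (Finset.mem_singleton.1 this) (hunivne L)
  · have : L'.near ∈ ({Finset.univ} : Finset (Finset (Fin 4))) := by rw [← hkappa]; simp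
    exact absurd (Finset.mem_singleton.1 this) (hunivne L')
  · have hl' : L'.len ≠ 0 := fun h => h1 (L'.v₁_eq_v₂_iff.2 h)
    have hl : L.len ≠ 0 := fun h => h2 (L.v₁_eq_v₂_iff.2 h)
    have hmem : L.near ∈ ({L'.near, L'.nearᶜ} : Finset (Finset (Fin 4))) := by rw [hkappa]; simp
    simp only [Finset.mem_insert, Finset.mem_singleton] at hmem
    rcases hmem with h | h
    · exact ⟨L', fun _ => rfl, rfl, h.symm, by simp [hl, hl']⟩
    · have he := L'.eq_ofNear
      refine ⟨ofNear L'.nearᶜ (card_compl_near L'.card_near)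
        (L'.v₁ + L'.len • intVec (edgeDir L'.near)) L'.len L'.len_nonneg, fun i => ?_, ?_, h.symm,
        by simp [hl, hl', ofNear]⟩
      · conv_rhs => rw [he]
        exact ray_congr (ofNear_compl_base _ _ _ i)
      · conv_rhs => rw [he]
        exact ofNear_compl_seg _ _ _

end TropPoly

end TropGeom

theorem mainTheorem5 (f : TropGeom.TropPoly) (δ : ℕ) (hδ : 3 ≤ δ)
    (hdeg : f.HasDegree δ) (hsmooth : f.IsSmooth)
    (L : TropGeom.TropLine) (hL : L.carrier ⊆ f.surface) (hiso : f.IsIsolated L)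
    (L' : TropGeom.TropLine) (hL' : L'.carrier ⊆ f.surface)
    (hdata : f.data L' = f.data L) :
    L'.carrier = L.carrier :=
  TropGeom.TropPoly.carrier_eq_of_data_eq hδ hdeg hsmooth hL hiso hL' hdata
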